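/- Let $E$ be the finite directed graph with vertices $v,w$ and six edges: two loops at $v$, three loops at $w$, and one edge with source $w$ and range $v$. Its vertex matrix, with entries $A(x,y)=|r^{-1}(x)\cap s^{-1}(y)|$, is $A=\begin{pmatrix}2&1\\0&3\end{pmatrix}$ with respect to $E^0=\{v,w\}$. Let $\mathcal{T}C^*(E)$ be the Toeplitz algebra of $E$, that is, the $C^*$-algebra generated by a universal family of mutually orthogonal projections $p_x$ ($x\in E^0$) and partial isometries $s_e$ ($e\in E^1$) with $s_e^*s_e=p_{s(e)}$ and $p_x\ge\sum_{r(e)=x}s_es_e^*$. Let $C^*(E)$ be the quotient of $\mathcal{T}C^*(E)$ by the closed ideal generated by the projections $p_x-\sum_{r(e)=x}s_es_e^*$. Let $\alpha$ be the action of $\mathbb{R}$ on $\mathcal{T}C^*(E)$ with $\alpha_t(p_x)=p_x$ and $\alpha_t(s_e)=e^{it}s_e$. For $\beta\in\mathbb{R}$, a KMS$_\beta$ state is a state $\phi$ of $\mathcal{T}C^*(E)$ with $\phi(ab)=\phi(b\,\alpha_{i\beta}(a))$ for all elements $a,b$ that are analytic for $\alpha$. We say that $\phi$ factors through a quotient $q$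 of $\mathcal{T}C^*(E)$ if $\phi=\psi\circ q$ for some state $\psi$ of the quotient algebra. The set $\{w\}$ is hereditary (no edge has range $w$ and source $v$). Let $E\backslash\{w\}$ be the graph with the one vertex $v$ and its two loops, and let $\mathcal{T}C^*(E)\to\mathcal{T}C^*(E\backslash\{w\})$ be the quotient map that sends $p_w$ and all $s_e$ with $s(e)=w$ to $0$ and the other generators to the generators of the same name. Then: 1. For $\beta>\ln 3$, the KMS$_\beta$ states of $\mathcal{T}C^*(E)$ form a one-dimensional simplex, and none of them factors through $C^*(E)$. 2. The KMS$_{\ln 3}$ states of $\mathcal{T}C^*(E)$ form a simplex with exactly two extreme points $\phi_v\ne\phi_w$, where $\phi_v(p_v)=1$, $\phi_v(p_w)=0$ and $\phi_w(p_v)=\phi_w(p_w)=\tfrac12$. Among all KMS$_{\ln 3}$ states, only $\phi_w$ factors through $C^*(E)$ (and it does). 3. For $\ln 2\le\beta<\ln 3$, there is a unique KMS$_\beta$ state $\phi_v$ of $\mathcal{T}C^*(E)$. It satisfies $\phi_v(p_v)=1$ and $\phi_v(p_w)=0$, and it factors through the quotient map $\mathcal{T}C^*(E)\to\mathcal{T}C^*(E\backslash\{w\})$.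 It factors through $C^*(E)$ if and only if $\beta=\ln 2$. 4. For $\beta<\ln 2$, there are no KMS$_\beta$ states of $\mathcal{T}C^*(E)$. -/

import Mathlib

open scoped ComplexOrder

noncomputable section

namespace GraphAlgebra

/-! ## Finite directed graphs -/

/-- A finite directed graph `E = (E⁰, E¹, r, s)`. -/
structure FinGraph where
  /-- the vertices `E⁰` -/
  V : Type
  /-- the edges `E¹` -/
  Edge : Type
  [fintypeV : Fintype V]
  [fintypeEdge : Fintype Edge]
  /-- the range map -/
  r : Edge → V
  /-- the source map -/
  s : Edge → V

attribute [instance] FinGraph.fintypeV FinGraph.fintypeEdge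

open scoped Classical in
/-- The vertex matrix `A(v,w) = |r⁻¹(v) ∩ s⁻¹(w)|`. -/
def FinGraph.vertexMatrix (E : FinGraph) : Matrix E.V E.V ℕ :=
  fun v w => (Finset.univ.filter fun e : E.Edge => E.r e = v ∧ E.s e = w).card

/-- `v ≤ w`: there is a finite path `μ` (possibly of length `0`) with `r(μ) = v`, `s(μ) = w`. -/
def FinGraph.Reaches (E : FinGraph) : E.V → E.V → Prop :=
  Relation.ReflTransGen fun v w => ∃ e, E.r e = v ∧ E.s e = w

/-- A set `H` of vertices is hereditary if `v ∈ H` and `v ≤ w` imply `w ∈ H`. -/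
def FinGraph.IsHereditary (E : FinGraph) (H : Set E.V) : Prop :=
  ∀ v w, v ∈ H → E.Reaches v w → w ∈ H

theorem FinGraph.IsHereditary.r_notMem {E : FinGraph} {H : Set E.V} (hH : E.IsHereditary H)
    {e : E.Edge} (he : E.s e ∉ H) : E.r e ∉ H :=
  fun h => he (hH _ _ h (Relation.ReflTransGen.single ⟨e, rfl, rfl⟩))

open scoped Classical in
/-- The graph `E \ H = (E⁰ \ H, E¹ ∩ s⁻¹(E⁰ \ H), r, s)` for a hereditary set `H`. -/
def FinGraph.delete (E : FinGraph) (H : Set E.V) (hH : E.IsHereditary H) : FinGraph where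
  V := {v : E.V // v ∉ H}
  Edge := {e : E.Edge // E.s e ∉ H}
  r e := ⟨E.r e.1, hH.r_notMem e.2⟩
  s e := ⟨E.s e.1, e.2⟩

/-! ## Toeplitz-Cuntz-Krieger families -/

section Family

variable (E : FinGraph)

open scoped Classical in
/-- A Toeplitz-Cuntz-Krieger `E`-family in a C*-algebra `B`: mutually orthogonal projections `P v`
and partial isometries `S e` with `S e* S e = P (s e)` and `P v ≥ ∑_{r e = v} S e S e*`. (The
inequality says that the difference is a positive element of the C*-algebra, that is, of the
form `b* b`; the `S e` are partial isometries because the `S e* S e` are projections.) -/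
structure TCKFamily (B : Type*) [NonUnitalCStarAlgebra B] where
  P : E.V → B
  S : E.Edge → B
  isStarProjection : ∀ v, IsStarProjection (P v)
  orthogonal : ∀ v w, v ≠ w → P v * P w = 0
  star_mul_self : ∀ e, star (S e) * S e = P (E.s e)
  sum_le : ∀ v, ∃ b : B, P v - ∑ e with E.r e = v, S e * star (S e) = star b * b

/-- Formal `*`-polynomials in symbols for the vertices and edges of `E`. -/
inductive StarPoly : Type
  | vert (v : E.V) : StarPoly
  | edge (e : E.Edge) : StarPoly
  | zero : StarPoly
  | add (x y : StarPoly) : StarPoly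
  | neg (x : StarPoly) : StarPoly
  | smul (c : ℂ) (x : StarPoly) : StarPoly
  | mul (x y : StarPoly) : StarPoly
  | star (x : StarPoly) : StarPoly

end Family

variable {E : FinGraph}

/-- The value of a `*`-polynomial at a Toeplitz-Cuntz-Krieger family. -/
def TCKFamily.eval {B : Type*} [NonUnitalCStarAlgebra B] (F : TCKFamily E B) : StarPoly E → B
  | .vert v => F.P v
  | .edge e => F.S e
  | .zero => 0
  | .add x y => F.eval x + F.eval y
  | .neg x => -F.eval x
  | .smul c x => c • F.eval x
  | .mul x y => F.eval x * F.eval y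
  | .star x => Star.star (F.eval x)

theorem TCKFamily.norm_P_le {B : Type*} [NonUnitalCStarAlgebra B] (F : TCKFamily E B) (v : E.V) :
    ‖F.P v‖ ≤ 1 := by
  have h := F.isStarProjection v
  have h1 : ‖F.P v‖ * ‖F.P v‖ = ‖F.P v‖ := by
    rw [← CStarRing.norm_star_mul_self, h.isSelfAdjoint.star_eq, h.isIdempotentElem.eq]
  nlinarith [norm_nonneg (F.P v)]

theorem TCKFamily.norm_S_le {B : Type*} [NonUnitalCStarAlgebra B] (F : TCKFamily E B)
    (e : E.Edge) : ‖F.S e‖ ≤ 1 := by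
  have h1 : ‖F.S e‖ * ‖F.S e‖ ≤ 1 := by
    rw [← CStarRing.norm_star_mul_self, F.star_mul_self]
    exact F.norm_P_le _
  nlinarith [norm_nonneg (F.S e)]

/-- A syntactic bound for the norm of the values of a `*`-polynomial. -/
def StarPoly.bound : StarPoly E → ℝ
  | .vert _ => 1
  | .edge _ => 1
  | .zero => 0
  | .add x y => x.bound + y.bound
  | .neg x => x.bound
  | .smul c x => ‖c‖ * x.bound
  | .mul x y => x.bound * y.bound
  | .star x => x.bound

theorem TCKFamily.norm_eval_le {B : Type*} [NonUnitalCStarAlgebra B] (F : TCKFamily E B)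
    (x : StarPoly E) : ‖F.eval x‖ ≤ x.bound := by
  induction x with
  | vert v => exact F.norm_P_le v
  | edge e => exact F.norm_S_le e
  | zero => simp [eval, StarPoly.bound]
  | add x y hx hy => exact (norm_add_le _ _).trans (add_le_add hx hy)
  | neg x hx => simpa [eval, StarPoly.bound] using hx
  | smul c x hx =>
    simpa [eval, StarPoly.bound, norm_smul] using mul_le_mul_of_nonneg_left hx (norm_nonneg c)
  | mul x y hx hy =>
    exact (norm_mul_le _ _).trans
      (mul_le_mul hx hy (norm_nonneg _) ((norm_nonneg _).trans hx))
  | star x hx => simpa [eval, StarPoly.bound] using hx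

/-- The zero family. -/
def TCKFamily.zero (E : FinGraph) (B : Type*) [NonUnitalCStarAlgebra B] : TCKFamily E B where
  P _ := 0
  S _ := 0
  isStarProjection _ := IsStarProjection.zero _
  orthogonal _ _ _ := by simp
  star_mul_self _ := by simp
  sum_le _ := ⟨0, by simp⟩

/-! ## The universal `*`-algebra with its universal C*-norm -/

variable (E) in
/-- Two `*`-polynomials are identified if they agree at every Toeplitz-Cuntz-Krieger family. -/
instance starPolySetoid : Setoid (StarPoly E) where
  r x y := ∀ (B : Type) [NonUnitalCStarAlgebra B] (F : TCKFamily E B), F.eval x = F.eval y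
  iseqv :=
    ⟨fun _ _ _ _ => rfl, fun {_ _} h B _ F => (h B F).symm,
      fun {_ _ _} h k B _ F => (h B F).trans (k B F)⟩

variable (E) in
/-- The `*`-algebra of all `*`-polynomials in a universal Toeplitz-Cuntz-Krieger family. -/
def PreToeplitz : Type := Quotient (starPolySetoid E)

namespace PreToeplitz

def mk (x : StarPoly E) : PreToeplitz E := Quotient.mk _ x

instance : Zero (PreToeplitz E) := ⟨mk .zero⟩

instance : Add (PreToeplitz E) :=
  ⟨Quotient.map₂ .add fun _ _ h _ _ k B _ F => by simp [TCKFamily.eval, h B F, k B F]⟩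

instance : Neg (PreToeplitz E) :=
  ⟨Quotient.map .neg fun _ _ h B _ F => by simp [TCKFamily.eval, h B F]⟩

instance : Mul (PreToeplitz E) :=
  ⟨Quotient.map₂ .mul fun _ _ h _ _ k B _ F => by simp [TCKFamily.eval, h B F, k B F]⟩

instance : Star (PreToeplitz E) :=
  ⟨Quotient.map .star fun _ _ h B _ F => by simp [TCKFamily.eval, h B F]⟩

instance : SMul ℂ (PreToeplitz E) :=
  ⟨fun c => Quotient.map (.smul c) fun _ _ h B _ F => by simp [TCKFamily.eval, h B F]⟩

/-- Evaluation at a Toeplitz-Cuntz-Krieger family. -/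
def eval {B : Type} [NonUnitalCStarAlgebra B] (F : TCKFamily E B) (x : PreToeplitz E) : B :=
  Quotient.lift F.eval
    (fun _ _ (h : ∀ (B : Type) [NonUnitalCStarAlgebra B] (_ : TCKFamily E B), _ = _) => h B F) x

section

variable {B : Type} [NonUnitalCStarAlgebra B] (F : TCKFamily E B)

theorem eval_mk (x : StarPoly E) : eval F (mk x) = F.eval x := rfl

theorem eval_zero : eval F (0 : PreToeplitz E) = 0 := rfl

theorem eval_add (x y : PreToeplitz E) : eval F (x + y) = eval F x + eval F y :=
  Quotient.inductionOn₂ x y fun _ _ => rfl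

theorem eval_neg (x : PreToeplitz E) : eval F (-x) = -eval F x :=
  Quotient.inductionOn x fun _ => rfl

theorem eval_mul (x y : PreToeplitz E) : eval F (x * y) = eval F x * eval F y :=
  Quotient.inductionOn₂ x y fun _ _ => rfl

theorem eval_star (x : PreToeplitz E) : eval F (star x) = star (eval F x) :=
  Quotient.inductionOn x fun _ => rfl

theorem eval_smul (c : ℂ) (x : PreToeplitz E) : eval F (c • x) = c • eval F x :=
  Quotient.inductionOn x fun _ => rfl

end

theorem ext_eval {x y : PreToeplitz E}
    (h : ∀ (B : Type) [NonUnitalCStarAlgebra B] (F : TCKFamily E B), eval F x = eval F y) :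
    x = y := by
  induction x using Quotient.inductionOn with | _ x
  induction y using Quotient.inductionOn with | _ y
  exact Quotient.sound fun B _ F => h B F

instance : NonUnitalRing (PreToeplitz E) where
  add_assoc x y z := ext_eval fun B _ F => by simp only [eval_add, add_assoc]
  zero_add x := ext_eval fun B _ F => by simp only [eval_add, eval_zero, zero_add]
  add_zero x := ext_eval fun B _ F => by simp only [eval_add, eval_zero, add_zero]
  add_comm x y := ext_eval fun B _ F => by simp only [eval_add, add_comm]
  neg_add_cancel x := ext_eval fun B _ F => by
    simp only [eval_add, eval_neg, eval_zero, neg_add_cancel]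
  nsmul := nsmulRec
  zsmul := zsmulRec
  left_distrib x y z := ext_eval fun B _ F => by simp only [eval_add, eval_mul, mul_add]
  right_distrib x y z := ext_eval fun B _ F => by simp only [eval_add, eval_mul, add_mul]
  zero_mul x := ext_eval fun B _ F => by simp only [eval_mul, eval_zero, zero_mul]
  mul_zero x := ext_eval fun B _ F => by simp only [eval_mul, eval_zero, mul_zero]
  mul_assoc x y z := ext_eval fun B _ F => by simp only [eval_mul, mul_assoc]

instance : StarRing (PreToeplitz E) where
  star_involutive x := ext_eval fun B _ F => by simp only [eval_star, star_star]
  star_mul x y := ext_eval fun B _ F => by simp only [eval_star, eval_mul, star_mul]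
  star_add x y := ext_eval fun B _ F => by simp only [eval_star, eval_add, star_add]

instance : Module ℂ (PreToeplitz E) where
  one_smul x := ext_eval fun B _ F => by simp only [eval_smul, one_smul]
  mul_smul c d x := ext_eval fun B _ F => by simp only [eval_smul, mul_smul]
  smul_zero c := ext_eval fun B _ F => by simp only [eval_smul, eval_zero, smul_zero]
  smul_add c x y := ext_eval fun B _ F => by simp only [eval_smul, eval_add, smul_add]
  add_smul c d x := ext_eval fun B _ F => by simp only [eval_smul, eval_add, add_smul]
  zero_smul x := ext_eval fun B _ F => by simp only [eval_smul, eval_zero, zero_smul]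

/-- The universal norm: the supremum of `‖F.eval x‖` over all Toeplitz-Cuntz-Krieger families
`F` in C*-algebras. -/
instance : Norm (PreToeplitz E) :=
  ⟨fun x => sSup {c : ℝ | ∃ (B : Type) (_ : NonUnitalCStarAlgebra B) (F : TCKFamily E B),
    c = ‖eval F x‖}⟩

theorem norm_def (x : PreToeplitz E) :
    ‖x‖ = sSup {c : ℝ | ∃ (B : Type) (_ : NonUnitalCStarAlgebra B) (F : TCKFamily E B),
      c = ‖eval F x‖} := rfl

theorem norm_eval_le {B : Type} [hB : NonUnitalCStarAlgebra B] (F : TCKFamily E B)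
    (x : PreToeplitz E) : ‖eval F x‖ ≤ ‖x‖ := by
  refine le_csSup ?_ ⟨B, hB, F, rfl⟩
  induction x using Quotient.inductionOn with | _ x
  exact ⟨x.bound, by rintro _ ⟨B, _, F, rfl⟩; exact F.norm_eval_le x⟩

theorem norm_le {x : PreToeplitz E} {c : ℝ}
    (h : ∀ (B : Type) [NonUnitalCStarAlgebra B] (F : TCKFamily E B), ‖eval F x‖ ≤ c) :
    ‖x‖ ≤ c := by
  refine csSup_le ⟨_, ℂ, inferInstance, TCKFamily.zero E ℂ, rfl⟩ ?_
  rintro _ ⟨B, _, F, rfl⟩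
  exact h B F

theorem norm_nonneg' (x : PreToeplitz E) : 0 ≤ ‖x‖ :=
  (norm_nonneg _).trans (norm_eval_le (TCKFamily.zero E ℂ) x)

instance : NormedAddCommGroup (PreToeplitz E) :=
  AddGroupNorm.toNormedAddCommGroup
    { toFun := fun x => ‖x‖
      map_zero' := le_antisymm (norm_le fun B _ F => by simp [eval_zero]) (norm_nonneg' _)
      add_le' := fun x y => norm_le fun B _ F => by
        rw [eval_add]
        exact (norm_add_le _ _).trans (add_le_add (norm_eval_le F x) (norm_eval_le F y))
      neg' := fun x => le_antisymm
        (norm_le fun B _ F => by rw [eval_neg, norm_neg]; exact norm_eval_le F x)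
        (norm_le fun B _ F => by
          rw [← norm_neg, ← eval_neg]; exact norm_eval_le F (-x))
      eq_zero_of_map_eq_zero' := fun x hx => ext_eval fun B _ F => by
        rw [eval_zero, ← norm_le_zero_iff]
        exact (norm_eval_le F x).trans hx.le }

instance : NonUnitalNormedRing (PreToeplitz E) where
  __ : NonUnitalRing (PreToeplitz E) := inferInstance
  __ : NormedAddCommGroup (PreToeplitz E) := inferInstance
  norm_mul_le x y := norm_le fun B _ F => by
    rw [eval_mul]
    exact (norm_mul_le _ _).trans
      (mul_le_mul (norm_eval_le F x) (norm_eval_le F y) (norm_nonneg _) (norm_nonneg' _))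

instance : NormedSpace ℂ (PreToeplitz E) where
  norm_smul_le c x := norm_le fun B _ F => by
    rw [eval_smul, norm_smul]
    exact mul_le_mul_of_nonneg_left (norm_eval_le F x) (norm_nonneg c)

instance : IsScalarTower ℂ (PreToeplitz E) (PreToeplitz E) where
  smul_assoc c x y := ext_eval fun B _ F => by
    simp only [smul_eq_mul, eval_smul, eval_mul, smul_mul_assoc]

instance : SMulCommClass ℂ (PreToeplitz E) (PreToeplitz E) where
  smul_comm c x y := ext_eval fun B _ F => by
    simp only [smul_eq_mul, eval_smul, eval_mul, mul_smul_comm]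

instance : StarModule ℂ (PreToeplitz E) where
  star_smul c x := ext_eval fun B _ F => by simp only [eval_star, eval_smul, star_smul]

instance : CStarRing (PreToeplitz E) where
  norm_mul_self_le x := by
    have h : ‖x‖ ≤ √‖star x * x‖ := ?_
    · simpa [Real.mul_self_sqrt (norm_nonneg' (star x * x))] using
        mul_self_le_mul_self (norm_nonneg' x) h
    refine norm_le fun B _ F => ?_
    refine Real.le_sqrt_of_sq_le ?_
    rw [sq, ← CStarRing.norm_star_mul_self, ← eval_star, ← eval_mul]
    exact norm_eval_le F _

end PreToeplitz

/-! ## The Toeplitz algebra -/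

section Completion

open UniformSpace UniformSpace.Completion

variable (E) in
/-- The completion of the `*`-algebra of `*`-polynomials in a
universal Toeplitz-Cuntz-Krieger family in its universal C*-norm; only used to build `Toeplitz`. -/
def ToeplitzAux : Type := Completion (PreToeplitz E)

namespace ToeplitzAux

instance : NormedAddCommGroup (ToeplitzAux E) :=
  inferInstanceAs (NormedAddCommGroup (Completion (PreToeplitz E)))

instance : NormedSpace ℂ (ToeplitzAux E) :=
  inferInstanceAs (NormedSpace ℂ (Completion (PreToeplitz E)))

instance : CompleteSpace (ToeplitzAux E) :=
  inferInstanceAs (CompleteSpace (Completion (PreToeplitz E)))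

instance : ContinuousConstSMul ℂ (ToeplitzAux E) :=
  inferInstanceAs (ContinuousConstSMul ℂ (Completion (PreToeplitz E)))

instance : IsTopologicalAddGroup (ToeplitzAux E) :=
  SeminormedAddCommGroup.toIsTopologicalAddGroup

/-- The inclusion of the dense `*`-subalgebra of `*`-polynomials. -/
def incl : PreToeplitz E →ₗᵢ[ℂ] ToeplitzAux E := toComplₗᵢ

theorem denseRange_incl : DenseRange (incl (E := E)) := denseRange_coe

theorem isDenseInducing_incl : IsDenseInducing (incl (E := E)) := isDenseInducing_coe

theorem induction_on {p : ToeplitzAux E → Prop} (a : ToeplitzAux E) (hp : IsClosed {a | p a})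
    (ih : ∀ x, p (incl x)) : p a :=
  denseRange_incl.induction_on a hp ih

theorem induction_on₂ {p : ToeplitzAux E → ToeplitzAux E → Prop} (a b : ToeplitzAux E)
    (hp : IsClosed {q : ToeplitzAux E × ToeplitzAux E | p q.1 q.2})
    (ih : ∀ x y, p (incl x) (incl y)) : p a b :=
  (denseRange_incl.prodMap denseRange_incl).induction_on
    (p := fun q : ToeplitzAux E × ToeplitzAux E => p q.1 q.2) (a, b) hp fun x => ih x.1 x.2

theorem induction_on₃ {p : ToeplitzAux E → ToeplitzAux E → ToeplitzAux E → Prop} (a b c : ToeplitzAux E)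
    (hp : IsClosed {q : ToeplitzAux E × ToeplitzAux E × ToeplitzAux E | p q.1 q.2.1 q.2.2})
    (ih : ∀ x y z, p (incl x) (incl y) (incl z)) : p a b c :=
  (denseRange_incl.prodMap (denseRange_incl.prodMap denseRange_incl)).induction_on
    (p := fun q : ToeplitzAux E × ToeplitzAux E × ToeplitzAux E => p q.1 q.2.1 q.2.2) (a, b, c) hp
    fun x => ih x.1 x.2.1 x.2.2

instance : Mul (ToeplitzAux E) :=
  ⟨Function.curry <| (isDenseInducing_incl.prodMap isDenseInducing_incl).extend
    (incl ∘ Function.uncurry (· * ·))⟩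

instance : Star (ToeplitzAux E) := ⟨isDenseInducing_incl.extend (incl ∘ star)⟩

theorem continuous_mul' : Continuous fun q : ToeplitzAux E × ToeplitzAux E => q.1 * q.2 := by
  let m := (AddMonoidHom.mul : PreToeplitz E →+ PreToeplitz E →+ PreToeplitz E).compr₂
    (incl (E := E)).toLinearMap.toAddMonoidHom
  have : Continuous fun p : PreToeplitz E × PreToeplitz E => m p.1 p.2 :=
    incl.continuous.comp continuous_mul
  have di : IsDenseInducing (incl (E := E)).toLinearMap.toAddMonoidHom := isDenseInducing_incl
  exact di.extend_Z_bilin di this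

instance : ContinuousMul (ToeplitzAux E) := ⟨continuous_mul'⟩

theorem incl_mul (x y : PreToeplitz E) : incl (x * y) = incl x * incl y :=
  ((isDenseInducing_incl.prodMap isDenseInducing_incl).extend_eq
      (incl.continuous.comp continuous_mul) (x, y)).symm

theorem incl_star (x : PreToeplitz E) : incl (star x) = star (incl x) :=
  (isDenseInducing_incl.extend_eq (incl.continuous.comp continuous_star) x).symm

instance : ContinuousStar (ToeplitzAux E) where
  continuous_star := by
    have h : UniformContinuous (incl (E := E) ∘ star) :=
      incl.isometry.uniformContinuous.comp (starₗᵢ ℂ).isometry.uniformContinuous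
    exact uniformContinuous_uniformly_extend (isUniformInducing_coe _) denseRange_incl h 
      |>.continuous

theorem smul_mul' (c : ℂ) (a b : ToeplitzAux E) : (c • a) * b = c • (a * b) := by
  induction a, b using induction_on₂ with
  | hp => exact isClosed_eq ((continuous_fst.const_smul c).mul continuous_snd) ((continuous_fst.mul continuous_snd).const_smul c)
  | ih a b => simp only [← incl_mul, ← map_smul, smul_mul_assoc]

theorem mul_smul' (c : ℂ) (a b : ToeplitzAux E) : a * (c • b) = c • (a * b) := by
  induction a, b using induction_on₂ with
  | hp => exact isClosed_eq (continuous_fst.mul (continuous_snd.const_smul c)) ((continuous_fst.mul continuous_snd).const_smul c)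
  | ih a b => simp only [← incl_mul, ← map_smul, mul_smul_comm]

theorem star_smul' (c : ℂ) (a : ToeplitzAux E) : star (c • a) = star c • star a := by
  induction a using induction_on with
  | hp =>
    exact isClosed_eq (continuous_id.const_smul c).star
      ((continuous_const_smul (star c)).comp continuous_star)
  | ih a => simp only [← incl_star, ← map_smul, star_smul]

instance : NonUnitalRing (ToeplitzAux E) where
  __ : NormedAddCommGroup (ToeplitzAux E) := inferInstance
  left_distrib a b c := by
    induction a, b, c using induction_on₃ with
    | hp => exact isClosed_eq (by fun_prop) (by fun_prop)
    | ih a b c =>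
      simp only [← map_add, ← incl_mul, mul_add]
  right_distrib a b c := by
    induction a, b, c using induction_on₃ with
    | hp => exact isClosed_eq (by fun_prop) (by fun_prop)
    | ih a b c =>
      simp only [← map_add, ← incl_mul, add_mul]
  zero_mul a := by
    induction a using induction_on with
    | hp => exact isClosed_eq (by fun_prop) (by fun_prop)
    | ih a =>
      rw [← map_zero incl, ← incl_mul, zero_mul]
  mul_zero a := by
    induction a using induction_on with
    | hp => exact isClosed_eq (by fun_prop) (by fun_prop)
    | ih a =>
      rw [← map_zero incl, ← incl_mul, mul_zero]
  mul_assoc a b c := by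
    induction a, b, c using induction_on₃ with
    | hp => exact isClosed_eq (by fun_prop) (by fun_prop)
    | ih a b c =>
      simp only [← incl_mul, mul_assoc]

instance : NonUnitalNormedRing (ToeplitzAux E) where
  __ : NonUnitalRing (ToeplitzAux E) := inferInstance
  __ : NormedAddCommGroup (ToeplitzAux E) := inferInstance
  norm_mul_le a b := by
    induction a, b using induction_on₂ with
    | hp => exact isClosed_le (by fun_prop) (by fun_prop)
    | ih a b =>
      simpa only [← incl_mul, LinearIsometry.norm_map] using norm_mul_le a b

instance : StarRing (ToeplitzAux E) where
  star_involutive a := by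
    induction a using induction_on with
    | hp => exact isClosed_eq (by fun_prop) (by fun_prop)
    | ih a =>
      simp only [← incl_star, star_star]
  star_mul a b := by
    induction a, b using induction_on₂ with
    | hp => exact isClosed_eq (by fun_prop) (by fun_prop)
    | ih a b =>
      simp only [← incl_star, ← incl_mul, star_mul]
  star_add a b := by
    induction a, b using induction_on₂ with
    | hp => exact isClosed_eq (by fun_prop) (by fun_prop)
    | ih a b =>
      simp only [← incl_star, ← map_add, star_add]

instance : CStarRing (ToeplitzAux E) where
  norm_mul_self_le a := by
    induction a using induction_on with
    | hp => exact isClosed_le (by fun_prop) (by fun_prop)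
    | ih a =>
      simpa only [← incl_mul, ← incl_star, LinearIsometry.norm_map]
        using CStarRing.norm_mul_self_le a

instance : IsScalarTower ℂ (ToeplitzAux E) (ToeplitzAux E) := ⟨smul_mul'⟩

instance : SMulCommClass ℂ (ToeplitzAux E) (ToeplitzAux E) := ⟨fun c a b => (mul_smul' c a b).symm⟩

instance : StarModule ℂ (ToeplitzAux E) := ⟨star_smul'⟩

instance : NonUnitalCStarAlgebra (ToeplitzAux E) where

end ToeplitzAux

end Completion

variable (E) in
/-- The Toeplitz algebra `TC*(E)`, the C*-algebra generated by a universal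
Toeplitz-Cuntz-Krieger family: the completion of the `*`-algebra of `*`-polynomials in a
universal Toeplitz-Cuntz-Krieger family in its universal C*-norm. -/
def Toeplitz : Type := ToeplitzAux E

namespace Toeplitz

instance : NonUnitalCStarAlgebra (Toeplitz E) :=
  inferInstanceAs (NonUnitalCStarAlgebra (ToeplitzAux E))

/-- The inclusion of the dense `*`-subalgebra of `*`-polynomials. -/
def incl : PreToeplitz E →ₗᵢ[ℂ] Toeplitz E where
  toFun x := ToeplitzAux.incl x
  map_add' := map_add ToeplitzAux.incl
  map_smul' := map_smul ToeplitzAux.incl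
  norm_map' := ToeplitzAux.incl.norm_map

theorem denseRange_incl : DenseRange (incl (E := E)) := ToeplitzAux.denseRange_incl

theorem induction_on {p : Toeplitz E → Prop} (a : Toeplitz E) (hp : IsClosed {a | p a})
    (ih : ∀ x, p (incl x)) : p a :=
  denseRange_incl.induction_on a hp ih

theorem induction_on₂ {p : Toeplitz E → Toeplitz E → Prop} (a b : Toeplitz E)
    (hp : IsClosed {q : Toeplitz E × Toeplitz E | p q.1 q.2})
    (ih : ∀ x y, p (incl x) (incl y)) : p a b :=
  (denseRange_incl.prodMap denseRange_incl).induction_on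
    (p := fun q : Toeplitz E × Toeplitz E => p q.1 q.2) (a, b) hp fun x => ih x.1 x.2

theorem incl_mul (x y : PreToeplitz E) : incl (x * y) = incl x * incl y :=
  ToeplitzAux.incl_mul x y

theorem incl_star (x : PreToeplitz E) : incl (star x) = star (incl x) :=
  ToeplitzAux.incl_star x

end Toeplitz

/-! ## Gap projections and the universal family -/

section Gap

variable {B : Type*} [NonUnitalCStarAlgebra B]

open scoped Classical in
/-- The gap projection `P v - ∑_{r e = v} S e S e*`. -/
def TCKFamily.gap (F : TCKFamily E B) (v : E.V) : B :=
  F.P v - ∑ e with E.r e = v, F.S e * star (F.S e)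

theorem isStarProjection_mul_star {B : Type*} [NonUnitalCStarAlgebra B] {s : B}
    (hs : IsStarProjection (star s * s)) : IsStarProjection (s * star s) := by
  have h : s * star s * s = s := by
    have h0 : star (s * (star s * s) - s) * (s * (star s * s) - s) = 0 := by
      have := hs.isIdempotentElem.eq
      simp only [star_sub, star_mul, star_star, mul_sub, sub_mul]
      simp only [mul_assoc] at this ⊢
      simp [this]
    rw [CStarRing.star_mul_self_eq_zero_iff, sub_eq_zero] at h0
    rw [mul_assoc, h0]
  exact ⟨by rw [IsIdempotentElem, ← mul_assoc, h], .mul_star_self s⟩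

theorem TCKFamily.isStarProjection_range (F : TCKFamily E B) (e : E.Edge) :
    IsStarProjection (F.S e * star (F.S e)) :=
  isStarProjection_mul_star (by rw [F.star_mul_self]; exact F.isStarProjection _)

/-- If a projection dominates a finite sum of projections, then the difference is a projection. -/
theorem isStarProjection_sub_sum {ι : Type*} (s : Finset ι) {p : B} {q : ι → B}
    (hp : IsStarProjection p) (hq : ∀ i ∈ s, IsStarProjection (q i))
    (h : ∃ b, p - ∑ i ∈ s, q i = star b * b) : IsStarProjection (p - ∑ i ∈ s, q i) := by
  classical
  let _ := CStarAlgebra.spectralOrder B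
  let _ := CStarAlgebra.spectralOrderedRing B
  have hle : ∑ i ∈ s, q i ≤ p := by
    obtain ⟨b, hb⟩ := h
    rw [← sub_nonneg, hb]
    exact star_mul_self_nonneg b
  have hq0 : ∀ i ∈ s, 0 ≤ q i := fun i hi => (hq i hi).nonneg
  have hpq : ∀ i ∈ s, p * q i = q i := fun i hi =>
    ((hq i hi).le_iff_mul_eq_right hp).1 ((Finset.single_le_sum hq0 hi).trans hle)
  have hqp : ∀ i ∈ s, q i * p = q i := fun i hi =>
    ((hq i hi).le_iff_mul_eq_left hp).1 ((Finset.single_le_sum hq0 hi).trans hle)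
  have horth : ∀ i ∈ s, ∀ j ∈ s, i ≠ j → q i * q j = 0 := by
    intro i hi j hj hij
    have h1 : q j + q i ≤ p := by
      refine le_trans ?_ hle
      rw [← Finset.add_sum_erase s q hj]
      gcongr
      exact Finset.single_le_sum (f := q) (fun k hk => hq0 k (Finset.mem_of_mem_erase hk))
        (Finset.mem_erase.2 ⟨hij, hi⟩)
    have h2 : 0 ≤ star (q j) * (p - (q j + q i)) * q j :=
      star_left_conjugate_nonneg (sub_nonneg.2 h1) _
    have hj' := (hq j hj).isSelfAdjoint.star_eq
    have hi' := (hq i hi).isSelfAdjoint.star_eq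
    have hjj := (hq j hj).isIdempotentElem.eq
    have hii := (hq i hi).isIdempotentElem.eq
    have h3 : star (q j) * (p - (q j + q i)) * q j = -(star (q i * q j) * (q i * q j)) := by
      have e1 : q j * (q i * (q i * q j)) = q j * (q i * q j) := by
        rw [← mul_assoc (q i), hii]
      simp only [star_mul, hj', hi', mul_sub, sub_mul, mul_add, add_mul, hqp j hj, hjj,
        mul_assoc, e1]
      abel
    rw [h3] at h2
    have h4 := le_antisymm (neg_nonneg.1 h2) (star_mul_self_nonneg _)
    exact (CStarRing.star_mul_self_eq_zero_iff _).1 h4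
  have hsum : IsStarProjection (∑ i ∈ s, q i) := by
    refine ⟨?_, isSelfAdjoint_sum s fun i hi => (hq i hi).isSelfAdjoint⟩
    rw [IsIdempotentElem, Finset.sum_mul_sum]
    refine Finset.sum_congr rfl fun i hi => ?_
    rw [Finset.sum_eq_single i (fun j hj hji => horth i hi j hj hji.symm)
      (fun h => absurd hi h)]
    exact (hq i hi).isIdempotentElem
  refine hsum.sub_of_mul_eq_right hp ?_
  rw [Finset.mul_sum]
  exact Finset.sum_congr rfl hpq

theorem TCKFamily.isStarProjection_gap (F : TCKFamily E B) (v : E.V) :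
    IsStarProjection (F.gap v) :=
  isStarProjection_sub_sum _ (F.isStarProjection v) (fun e _ => F.isStarProjection_range e)
    (F.sum_le v)

end Gap

theorem PreToeplitz.eval_sum {B : Type} [NonUnitalCStarAlgebra B] (F : TCKFamily E B) {ι : Type*}
    (s : Finset ι) (f : ι → PreToeplitz E) :
    eval F (∑ i ∈ s, f i) = ∑ i ∈ s, eval F (f i) := by
  classical
  induction s using Finset.induction_on with
  | empty => exact eval_zero F
  | insert i s hi ih => rw [Finset.sum_insert hi, Finset.sum_insert hi, eval_add, ih]

theorem PreToeplitz.eval_sub {B : Type} [NonUnitalCStarAlgebra B] (F : TCKFamily E B)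
    (x y : PreToeplitz E) : eval F (x - y) = eval F x - eval F y := by
  rw [sub_eq_add_neg, eval_add, eval_neg, sub_eq_add_neg]

namespace Toeplitz

theorem sum_le_aux (v : E.V) : open scoped Classical in
    IsStarProjection (PreToeplitz.mk (.vert v) -
      ∑ e with E.r e = v, PreToeplitz.mk (.edge e) * star (PreToeplitz.mk (.edge e))) := by
  classical
  have key : ∀ (B : Type) [NonUnitalCStarAlgebra B] (F : TCKFamily E B),
      PreToeplitz.eval F (PreToeplitz.mk (.vert v) -
      ∑ e with E.r e = v, PreToeplitz.mk (.edge e) * star (PreToeplitz.mk (.edge e)))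
        = F.gap v := by
    intro B _ F
    simp only [PreToeplitz.eval_sub, PreToeplitz.eval_sum, PreToeplitz.eval_mul,
      PreToeplitz.eval_star, PreToeplitz.eval_mk, TCKFamily.eval, TCKFamily.gap]
  refine ⟨PreToeplitz.ext_eval fun B _ F => ?_, PreToeplitz.ext_eval fun B _ F => ?_⟩
  · rw [PreToeplitz.eval_mul, key, (F.isStarProjection_gap v).isIdempotentElem.eq]
  · rw [PreToeplitz.eval_star, key, (F.isStarProjection_gap v).isSelfAdjoint.star_eq]

variable (E) in
/-- The universal Toeplitz-Cuntz-Krieger family `(p, s)` generating `TC*(E)`. -/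
def univ : TCKFamily E (Toeplitz E) where
  P v := incl (PreToeplitz.mk (.vert v))
  S e := incl (PreToeplitz.mk (.edge e))
  isStarProjection v := by
    refine ⟨?_, ?_⟩
    · rw [IsIdempotentElem, ← incl_mul]
      congr 1
      exact PreToeplitz.ext_eval fun B _ F => (F.isStarProjection v).isIdempotentElem.eq
    · rw [IsSelfAdjoint, ← incl_star]
      congr 1
      exact PreToeplitz.ext_eval fun B _ F => (F.isStarProjection v).isSelfAdjoint.star_eq
  orthogonal v w h := by
    rw [← incl_mul, ← map_zero incl]
    congr 1
    exact PreToeplitz.ext_eval fun B _ F => F.orthogonal v w h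
  star_mul_self e := by
    rw [← incl_star, ← incl_mul]
    congr 1
    exact PreToeplitz.ext_eval fun B _ F => F.star_mul_self e
  sum_le v := by
    classical
    have h := sum_le_aux (E := E) v
    refine ⟨incl (PreToeplitz.mk (.vert v) -
      ∑ e with E.r e = v, PreToeplitz.mk (.edge e) * star (PreToeplitz.mk (.edge e))), ?_⟩
    rw [← incl_star, ← incl_mul, h.isSelfAdjoint.star_eq, h.isIdempotentElem.eq, map_sub, map_sum]
    simp only [incl_mul, incl_star]

/-- The projection `p_v` in `TC*(E)`. -/
def p (v : E.V) : Toeplitz E := (univ E).P v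

/-- The partial isometry `s_e` in `TC*(E)`. -/
def s (e : E.Edge) : Toeplitz E := (univ E).S e

section Lift

variable {B : Type} [NonUnitalCStarAlgebra B]

/-- Evaluation at a family, as a continuous linear map. -/
def evalL (F : TCKFamily E B) : PreToeplitz E →L[ℂ] B :=
  LinearMap.mkContinuous
    { toFun := PreToeplitz.eval F
      map_add' := PreToeplitz.eval_add F
      map_smul' := PreToeplitz.eval_smul F } 1
    fun x => by simpa using PreToeplitz.norm_eval_le F x

theorem evalL_apply (F : TCKFamily E B) (x : PreToeplitz E) :
    evalL F x = PreToeplitz.eval F x := rfl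

/-- The continuous extension of the evaluation at a family to `TC*(E)`. -/
def liftL (F : TCKFamily E B) : Toeplitz E →L[ℂ] B := (evalL F).extend incl.toContinuousLinearMap

theorem liftL_incl (F : TCKFamily E B) (x : PreToeplitz E) :
    liftL F (incl x) = PreToeplitz.eval F x :=
  (evalL F).extend_eq (e := incl.toContinuousLinearMap) denseRange_incl
    incl.isometry.isUniformInducing x

/-- The homomorphism `π_{P,S} : TC*(E) → B` given by the universal property. -/
def lift (F : TCKFamily E B) : Toeplitz E →⋆ₙₐ[ℂ] B where
  toFun := liftL F
  map_smul' c a := map_smul (liftL F) c a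
  map_zero' := map_zero (liftL F)
  map_add' := map_add (liftL F)
  map_mul' a b := by
    induction a, b using induction_on₂ with
    | hp => exact isClosed_eq (by fun_prop) (by fun_prop)
    | ih a b => simp only [← incl_mul, liftL_incl, PreToeplitz.eval_mul]
  map_star' a := by
    induction a using induction_on with
    | hp => exact isClosed_eq (by fun_prop) (by fun_prop)
    | ih a => simp only [← incl_star, liftL_incl, PreToeplitz.eval_star]

theorem lift_p (F : TCKFamily E B) (v : E.V) : lift F (p v) = F.P v := liftL_incl F _

theorem lift_s (F : TCKFamily E B) (e : E.Edge) : lift F (s e) = F.S e := liftL_incl F _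

/-- `TC*(E)` is generated by the universal family: a homomorphism is determined by its values on
the `p_v` and the `s_e`. -/
theorem hom_ext {f g : Toeplitz E →⋆ₙₐ[ℂ] B} (hp : ∀ v, f (p v) = g (p v))
    (hs : ∀ e, f (s e) = g (s e)) : f = g := by
  have hf : Continuous f := AddMonoidHomClass.continuous_of_bound f 1 fun a => by
    simpa using NonUnitalStarAlgHom.norm_apply_le f a
  have hg : Continuous g := AddMonoidHomClass.continuous_of_bound g 1 fun a => by
    simpa using NonUnitalStarAlgHom.norm_apply_le g a
  ext a
  induction a using induction_on with
  | hp => exact isClosed_eq hf hg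
  | ih x =>
    induction x using Quotient.inductionOn with | _ x
    change f (incl (PreToeplitz.mk x)) = g (incl (PreToeplitz.mk x))
    induction x with
    | vert v => exact hp v
    | edge e => exact hs e
    | zero =>
      change f (incl 0) = g (incl 0)
      simp only [map_zero]
    | add x y hx hy =>
      change f (incl (PreToeplitz.mk x + PreToeplitz.mk y)) =
        g (incl (PreToeplitz.mk x + PreToeplitz.mk y))
      simp only [map_add, hx, hy]
    | neg x hx =>
      change f (incl (-PreToeplitz.mk x)) = g (incl (-PreToeplitz.mk x))
      simp only [map_neg, hx]
    | smul c x hx =>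
      change f (incl (c • PreToeplitz.mk x)) = g (incl (c • PreToeplitz.mk x))
      simp only [map_smul, hx]
    | mul x y hx hy =>
      change f (incl (PreToeplitz.mk x * PreToeplitz.mk y)) =
        g (incl (PreToeplitz.mk x * PreToeplitz.mk y))
      simp only [incl_mul, map_mul, hx, hy]
    | star x hx =>
      change f (incl (star (PreToeplitz.mk x))) = g (incl (star (PreToeplitz.mk x)))
      simp only [incl_star, map_star, hx]

end Lift

/-! ## The gauge action and the dynamics -/

theorem Circle.star_mul_self (z : Circle) : star (z : ℂ) * z = 1 := by
  have := Complex.normSq_eq_conj_mul_self (z := (z : ℂ))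
  rw [Circle.normSq_coe] at this
  simpa using this.symm

theorem Circle.mul_star_self (z : Circle) : (z : ℂ) * star (z : ℂ) = 1 := by
  rw [mul_comm, Circle.star_mul_self]

/-- The family `(p, z s)` for `z ∈ 𝕋`. -/
def gaugeFamily (E : FinGraph) (z : Circle) : TCKFamily E (Toeplitz E) where
  P := p
  S e := (z : ℂ) • s e
  isStarProjection := (univ E).isStarProjection
  orthogonal := (univ E).orthogonal
  star_mul_self e := by
    rw [star_smul, smul_mul_smul_comm, Circle.star_mul_self, one_smul]
    exact (univ E).star_mul_self e
  sum_le v := by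
    obtain ⟨b, hb⟩ := (univ E).sum_le v
    refine ⟨b, ?_⟩
    rw [← hb]
    congr 2 with e
    rw [star_smul, smul_mul_smul_comm, Circle.mul_star_self, one_smul]
    rfl

/-- The gauge action `γ_z` on `TC*(E)`, with `γ_z(p_v) = p_v` and `γ_z(s_e) = z s_e`. -/
def gauge (z : Circle) : Toeplitz E →⋆ₙₐ[ℂ] Toeplitz E := lift (gaugeFamily E z)

/-- The dynamics `α_t = γ_{e^{it}}`. -/
def dynamics (t : ℝ) : Toeplitz E →⋆ₙₐ[ℂ] Toeplitz E := gauge (Circle.exp t)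

end Toeplitz

/-! ## Quotients of C*-algebras by closed ideals -/

section Quotient

variable (A : Type*) [NonUnitalCStarAlgebra A]

/-- A closed two-sided (`*`-)ideal of a C*-algebra. -/
structure ClosedIdeal extends Submodule ℂ A where
  mul_mem_left : ∀ (a : A) {x : A}, x ∈ carrier → a * x ∈ carrier
  mul_mem_right : ∀ (a : A) {x : A}, x ∈ carrier → x * a ∈ carrier
  star_mem : ∀ {x : A}, x ∈ carrier → star x ∈ carrier
  isClosed : IsClosed carrier

variable {A}

/-- The underlying type of the quotient C*-algebra `A / J`; only used to build `CStarQuotient`. -/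
def QuotientAux (J : ClosedIdeal A) : Type _ := A ⧸ J.toSubmodule

namespace QuotientAux

variable (J : ClosedIdeal A)

instance : IsClosed (J.toSubmodule : Set A) := J.isClosed

instance : NormedAddCommGroup (QuotientAux J) :=
  inferInstanceAs (NormedAddCommGroup (A ⧸ J.toSubmodule))

instance : NormedSpace ℂ (QuotientAux J) :=
  inferInstanceAs (NormedSpace ℂ (A ⧸ J.toSubmodule))

instance : CompleteSpace (QuotientAux J) :=
  inferInstanceAs (CompleteSpace (A ⧸ J.toSubmodule))

/-- The quotient map. -/
def mk : A →ₗ[ℂ] QuotientAux J := J.toSubmodule.mkQ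

variable {J}

theorem mk_surjective : Function.Surjective (mk J) := J.toSubmodule.mkQ_surjective

theorem mk_eq_mk {x y : A} : mk J x = mk J y ↔ x - y ∈ J.toSubmodule :=
  Submodule.Quotient.eq J.toSubmodule

theorem norm_mk_le (x : A) : ‖mk J x‖ ≤ ‖x‖ := Submodule.Quotient.norm_mk_le J.toSubmodule x

theorem exists_norm_lt (x : QuotientAux J) {ε : ℝ} (hε : 0 < ε) :
    ∃ m : A, mk J m = x ∧ ‖m‖ < ‖x‖ + ε := Submodule.Quotient.norm_mk_lt (S := J.toSubmodule) x hε

instance : Mul (QuotientAux J) :=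
  ⟨fun x y => Quotient.map₂ (fun a b : A => a * b) (by
    intro a a' h b b' k
    have h' := (Submodule.quotientRel_def J.toSubmodule).1 h
    have k' := (Submodule.quotientRel_def J.toSubmodule).1 k
    refine (Submodule.quotientRel_def J.toSubmodule).2 ?_
    have e : a * b - a' * b' = (a - a') * b + a' * (b - b') := by
      simp only [sub_mul, mul_sub]; abel
    rw [e]
    exact J.toSubmodule.add_mem (J.mul_mem_right b h') (J.mul_mem_left a' k')) x y⟩

instance : Star (QuotientAux J) :=
  ⟨fun x => Quotient.map (fun a : A => star a) (by
    intro a a' h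
    refine (Submodule.quotientRel_def J.toSubmodule).2 ?_
    have h' := J.star_mem ((Submodule.quotientRel_def J.toSubmodule).1 h)
    rwa [star_sub] at h') x⟩

theorem mk_mul (a b : A) : mk J (a * b) = mk J a * mk J b := rfl

theorem mk_star (a : A) : mk J (star a) = star (mk J a) := rfl

instance : NonUnitalRing (QuotientAux J) where
  __ : NormedAddCommGroup (QuotientAux J) := inferInstance
  left_distrib x y z := by
    obtain ⟨a, rfl⟩ := mk_surjective x
    obtain ⟨b, rfl⟩ := mk_surjective y
    obtain ⟨c, rfl⟩ := mk_surjective z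
    simp only [← mk_mul, ← map_add, mul_add]
  right_distrib x y z := by
    obtain ⟨a, rfl⟩ := mk_surjective x
    obtain ⟨b, rfl⟩ := mk_surjective y
    obtain ⟨c, rfl⟩ := mk_surjective z
    simp only [← mk_mul, ← map_add, add_mul]
  zero_mul x := by
    obtain ⟨a, rfl⟩ := mk_surjective x
    rw [← map_zero (mk J), ← mk_mul, zero_mul]
  mul_zero x := by
    obtain ⟨a, rfl⟩ := mk_surjective x
    rw [← map_zero (mk J), ← mk_mul, mul_zero]
  mul_assoc x y z := by
    obtain ⟨a, rfl⟩ := mk_surjective x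
    obtain ⟨b, rfl⟩ := mk_surjective y
    obtain ⟨c, rfl⟩ := mk_surjective z
    simp only [← mk_mul, mul_assoc]

theorem smul_mul' (c : ℂ) (x y : QuotientAux J) : (c • x) * y = c • (x * y) := by
  obtain ⟨a, rfl⟩ := mk_surjective x
  obtain ⟨b, rfl⟩ := mk_surjective y
  simp only [← mk_mul, ← map_smul, smul_mul_assoc]

theorem mul_smul' (c : ℂ) (x y : QuotientAux J) : x * (c • y) = c • (x * y) := by
  obtain ⟨a, rfl⟩ := mk_surjective x
  obtain ⟨b, rfl⟩ := mk_surjective y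
  simp only [← mk_mul, ← map_smul, mul_smul_comm]

theorem star_smul' (c : ℂ) (x : QuotientAux J) : star (c • x) = star c • star x := by
  obtain ⟨a, rfl⟩ := mk_surjective x
  simp only [← mk_star, ← map_smul, star_smul]

instance : NonUnitalNormedRing (QuotientAux J) where
  __ : NonUnitalRing (QuotientAux J) := inferInstance
  __ : NormedAddCommGroup (QuotientAux J) := inferInstance
  norm_mul_le x y := by
    have key : ∀ ε : ℝ, 0 < ε → ‖x * y‖ ≤ (‖x‖ + ε) * (‖y‖ + ε) := by
      intro ε hε
      obtain ⟨a, rfl, ha⟩ := exists_norm_lt x hε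
      obtain ⟨b, rfl, hb⟩ := exists_norm_lt y hε
      rw [← mk_mul]
      exact (norm_mk_le _).trans ((norm_mul_le a b).trans
        (mul_le_mul ha.le hb.le (norm_nonneg _) ((norm_nonneg _).trans ha.le)))
    have hlim : Filter.Tendsto (fun ε : ℝ => (‖x‖ + ε) * (‖y‖ + ε)) (nhdsWithin 0 (Set.Ioi 0))
        (nhds ((‖x‖ + 0) * (‖y‖ + 0))) :=
      Filter.Tendsto.mono_left (Continuous.tendsto (by fun_prop) 0) nhdsWithin_le_nhds
    rw [add_zero, add_zero] at hlim
    exact ge_of_tendsto hlim (Filter.eventually_of_mem self_mem_nhdsWithin fun ε hε => key ε hε)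

instance : StarRing (QuotientAux J) where
  star_involutive x := by
    obtain ⟨a, rfl⟩ := mk_surjective x
    simp only [← mk_star, star_star]
  star_mul x y := by
    obtain ⟨a, rfl⟩ := mk_surjective x
    obtain ⟨b, rfl⟩ := mk_surjective y
    simp only [← mk_star, ← mk_mul, star_mul]
  star_add x y := by
    obtain ⟨a, rfl⟩ := mk_surjective x
    obtain ⟨b, rfl⟩ := mk_surjective y
    simp only [← mk_star, ← map_add, star_add]

theorem norm_conj_le [PartialOrder A] [StarOrderedRing A] {e : A} (he : 0 ≤ e) (he1 : ‖e‖ ≤ 1)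
    (y : A) : ‖y - e * y - y * e + e * y * e‖ ≤ ‖y‖ := by
  let _ := CStarAlgebra.spectralOrder (Unitization ℂ A)
  let _ := CStarAlgebra.spectralOrderedRing (Unitization ℂ A)
  have h0 : (0 : Unitization ℂ A) ≤ e := by
    obtain ⟨b, rfl⟩ := CStarAlgebra.nonneg_iff_eq_star_mul_self.1 he
    rw [Unitization.inr_mul, Unitization.inr_star]
    exact star_mul_self_nonneg _
  have h1 : (e : Unitization ℂ A) ∈ Set.Icc 0 1 :=
    CStarAlgebra.mem_Icc_iff_norm_le_one.2 ⟨h0, by rwa [Unitization.norm_inr]⟩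
  have h2 : ‖1 - (e : Unitization ℂ A)‖ ≤ 1 :=
    (CStarAlgebra.mem_Icc_iff_norm_le_one.1 (Set.sub_mem_Icc_zero_iff_right.2 h1)).2
  have h3 : ((y - e * y - y * e + e * y * e : A) : Unitization ℂ A) =
      (1 - (e : Unitization ℂ A)) * y * (1 - (e : Unitization ℂ A)) := by
    simp only [Unitization.inr_add, Unitization.inr_sub, Unitization.inr_mul, sub_mul, mul_sub,
      one_mul, mul_one]
    abel
  rw [← Unitization.norm_inr (𝕜 := ℂ), h3, ← Unitization.norm_inr (𝕜 := ℂ) (a := y)]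
  calc _ ≤ ‖1 - (e : Unitization ℂ A)‖ * ‖(y : Unitization ℂ A)‖ * ‖1 - (e : Unitization ℂ A)‖ :=
        (norm_mul_le _ _).trans (by gcongr; exact norm_mul_le _ _)
    _ ≤ 1 * ‖(y : Unitization ℂ A)‖ * 1 := by gcongr
    _ = _ := by ring

theorem norm_mk_sq_le (x j : A) (hj : j ∈ J.toSubmodule) :
    ‖mk J x‖ * ‖mk J x‖ ≤ ‖star x * x + j‖ := by
  let S : NonUnitalStarSubalgebra ℂ A :=
    { J.toSubmodule with
      mul_mem' := fun {a b} _ hb => J.mul_mem_left a hb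
      star_mem' := fun {a} ha => J.star_mem ha }
  have : IsClosed (S : Set A) := J.isClosed
  let _ := CStarAlgebra.spectralOrder A
  let _ := CStarAlgebra.spectralOrderedRing A
  let _ := CStarAlgebra.spectralOrder S
  let _ := CStarAlgebra.spectralOrderedRing S
  have hl := CStarAlgebra.increasingApproximateUnit S
  have hne := hl.neBot
  have key : ∀ᶠ e : S in CStarAlgebra.approximateUnit S,
      ‖mk J x‖ * ‖mk J x‖ ≤ ‖star x * x + j‖ + 2 * ‖j - (e : A) * j‖ := by
    filter_upwards [hl.eventually_nonneg, hl.eventually_norm] with e he0 he1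
    have he : (0 : A) ≤ e := by
      obtain ⟨b, rfl⟩ := CStarAlgebra.nonneg_iff_eq_star_mul_self.1 he0
      exact star_mul_self_nonneg (b : A)
    have he1' : ‖(e : A)‖ ≤ 1 := he1
    have hes : star (e : A) = e := (IsSelfAdjoint.of_nonneg he).star_eq
    have h1 : mk J x = mk J (x - x * e) := by
      rw [mk_eq_mk, sub_sub_cancel]
      exact J.mul_mem_left x e.2
    have h2 : star (x - x * (e : A)) * (x - x * e) =
        ((star x * x + j) - e * (star x * x + j) - (star x * x + j) * e
          + e * (star x * x + j) * e) - ((j - e * j) - (j - e * j) * e) := by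
      simp only [star_sub, star_mul, hes, sub_mul, mul_sub, mul_add, add_mul, mul_assoc]
      abel
    have h3 : ‖(j - e * j) - (j - e * j) * (e : A)‖ ≤ 2 * ‖j - (e : A) * j‖ := by
      refine (norm_sub_le _ _).trans ?_
      have : ‖(j - e * j) * (e : A)‖ ≤ ‖j - (e : A) * j‖ * 1 :=
        (norm_mul_le _ _).trans (by gcongr)
      linarith
    calc ‖mk J x‖ * ‖mk J x‖ ≤ ‖x - x * (e : A)‖ * ‖x - x * (e : A)‖ := by
          rw [h1]
          exact mul_self_le_mul_self (norm_nonneg _) (norm_mk_le _)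
      _ = ‖star (x - x * (e : A)) * (x - x * e)‖ := CStarRing.norm_star_mul_self.symm
      _ ≤ _ := by
          rw [h2]
          exact (norm_sub_le _ _).trans (add_le_add (norm_conj_le he he1' _) h3)
  have hlim : Filter.Tendsto (fun e : S => ‖star x * x + j‖ + 2 * ‖j - (e : A) * j‖)
      (CStarAlgebra.approximateUnit S) (nhds (‖star x * x + j‖ + 2 * ‖j - j‖)) := by
    have h := (continuous_subtype_val.tendsto _).comp (hl.tendsto_mul_right ⟨j, hj⟩)
    exact ((h.const_sub j).norm.const_mul 2).const_add _
  rw [sub_self, norm_zero, mul_zero, add_zero] at hlim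
  exact ge_of_tendsto hlim key

instance : CStarRing (QuotientAux J) where
  norm_mul_self_le x := by
    obtain ⟨a, rfl⟩ := mk_surjective x
    refine le_of_forall_pos_le_add fun ε hε => ?_
    obtain ⟨b, hb, hb'⟩ := exists_norm_lt (star (mk J a) * mk J a) hε
    rw [← mk_star, ← mk_mul, mk_eq_mk] at hb
    have := norm_mk_sq_le (J := J) a _ hb
    rw [add_sub_cancel] at this
    exact this.trans hb'.le

instance : NonUnitalCStarAlgebra (QuotientAux J) where
  smul_assoc := smul_mul'
  smul_comm c x y := (mul_smul' c x y).symm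
  star_smul := star_smul'

end QuotientAux

/-- The quotient C*-algebra `A / J` (with the quotient norm). -/
def CStarQuotient (J : ClosedIdeal A) : Type _ := QuotientAux J

instance (J : ClosedIdeal A) : NonUnitalCStarAlgebra (CStarQuotient J) :=
  inferInstanceAs (NonUnitalCStarAlgebra (QuotientAux J))

/-- The quotient map `A → A / J`. -/
def CStarQuotient.mk (J : ClosedIdeal A) : A →⋆ₙₐ[ℂ] CStarQuotient J where
  toFun a := QuotientAux.mk J a
  map_smul' := map_smul (QuotientAux.mk J)
  map_zero' := map_zero (QuotientAux.mk J)
  map_add' := map_add (QuotientAux.mk J)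
  map_mul' := QuotientAux.mk_mul
  map_star' := QuotientAux.mk_star

theorem CStarQuotient.mk_surjective (J : ClosedIdeal A) : Function.Surjective (mk J) :=
  QuotientAux.mk_surjective

theorem CStarQuotient.mk_eq_zero_iff (J : ClosedIdeal A) (a : A) :
    mk J a = 0 ↔ a ∈ J.toSubmodule :=
  Submodule.Quotient.mk_eq_zero J.toSubmodule

/-- The closed ideal generated by a set of self-adjoint elements: the intersection of all closed
two-sided ideals that contain it. -/
def ClosedIdeal.span (X : Set A) (hX : ∀ x ∈ X, IsSelfAdjoint x) : ClosedIdeal A where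
  toSubmodule := sInf {I : Submodule ℂ A | IsClosed (I : Set A) ∧
    (∀ a x : A, x ∈ I → a * x ∈ I ∧ x * a ∈ I) ∧ X ⊆ I}
  mul_mem_left a x hx := by
    refine Submodule.mem_sInf.2 fun I hI => (hI.2.1 a x ?_).1
    exact Submodule.mem_sInf.1 hx I hI
  mul_mem_right a x hx := by
    refine Submodule.mem_sInf.2 fun I hI => (hI.2.1 a x ?_).2
    exact Submodule.mem_sInf.1 hx I hI
  star_mem {x} hx := by
    refine Submodule.mem_sInf.2 fun I hI => ?_
    let I' : Submodule ℂ A :=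
      { carrier := {a | star a ∈ I}
        add_mem' := fun {a b} ha hb => by
          simp only [Set.mem_ofPred_eq, star_add] at *
          exact I.add_mem ha hb
        zero_mem' := by simp
        smul_mem' := fun c a ha => by
          simp only [Set.mem_ofPred_eq, star_smul] at *
          exact I.smul_mem _ ha }
    refine Submodule.mem_sInf.1 hx I' ⟨hI.1.preimage continuous_star, fun a y hy => ?_, ?_⟩
    · have := hI.2.1 (star a) (star y) hy
      refine ⟨?_, ?_⟩
      · change star (a * y) ∈ I
        rw [star_mul]; exact this.2
      · change star (y * a) ∈ I
        rw [star_mul]; exact this.1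
    · intro y hy
      change star y ∈ I
      rw [(hX y hy).star_eq]
      exact hI.2.2 hy
  isClosed := by
    change IsClosed ((sInf _ : Submodule ℂ A) : Set A)
    rw [Submodule.coe_sInf]
    exact isClosed_biInter fun I hI => hI.1

end Quotient

/-! ## The graph algebra and the quotient maps -/

/-- The closed ideal of `TC*(E)` generated by the gap projections. -/
def gapIdeal (E : FinGraph) : ClosedIdeal (Toeplitz E) :=
  ClosedIdeal.span (Set.range (Toeplitz.univ E).gap) (by
    rintro _ ⟨v, rfl⟩
    exact ((Toeplitz.univ E).isStarProjection_gap v).isSelfAdjoint)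

/-- The graph algebra `C*(E)`. -/
abbrev CuntzKrieger (E : FinGraph) : Type := CStarQuotient (gapIdeal E)

/-- The quotient map `TC*(E) → C*(E)`. -/
def toCuntzKrieger (E : FinGraph) : Toeplitz E →⋆ₙₐ[ℂ] CuntzKrieger E :=
  CStarQuotient.mk (gapIdeal E)

section Delete

variable (H : Set E.V) (hH : E.IsHereditary H)

open scoped Classical in
/-- `p_v` in `TC*(E \ H)` if `v ∉ H`, and `0` if `v ∈ H`. -/
def deleteP (v : E.V) : Toeplitz (E.delete H hH) :=
  if h : v ∉ H then Toeplitz.p (E := E.delete H hH) ⟨v, h⟩ else 0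

open scoped Classical in
/-- `s_e` in `TC*(E \ H)` if `s(e) ∉ H`, and `0` if `s(e) ∈ H`. -/
def deleteS (e : E.Edge) : Toeplitz (E.delete H hH) :=
  if h : E.s e ∉ H then Toeplitz.s (E := E.delete H hH) ⟨e, h⟩ else 0

variable {H}

theorem deleteP_of_notMem {v : E.V} (h : v ∉ H) :
    deleteP H hH v = Toeplitz.p (E := E.delete H hH) ⟨v, h⟩ := dif_pos h

theorem deleteP_of_mem {v : E.V} (h : v ∈ H) : deleteP H hH v = 0 := dif_neg (not_not.2 h)

theorem deleteS_of_notMem {e : E.Edge} (h : E.s e ∉ H) :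
    deleteS H hH e = Toeplitz.s (E := E.delete H hH) ⟨e, h⟩ := dif_pos h

theorem deleteS_of_mem {e : E.Edge} (h : E.s e ∈ H) : deleteS H hH e = 0 := dif_neg (not_not.2 h)

/-- The family in `TC*(E \ H)` obtained by putting `P v = 0` for `v ∈ H` and `S e = 0` for
`s(e) ∈ H`. -/
def deleteFamily : TCKFamily E (Toeplitz (E.delete H hH)) where
  P := deleteP H hH
  S := deleteS H hH
  isStarProjection v := by
    by_cases h : v ∈ H
    · rw [deleteP_of_mem hH h]
      exact .zero _
    · rw [deleteP_of_notMem hH h]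
      exact (Toeplitz.univ (E.delete H hH)).isStarProjection _
  orthogonal v w hvw := by
    by_cases h : v ∈ H
    · rw [deleteP_of_mem hH h, zero_mul]
    by_cases h' : w ∈ H
    · rw [deleteP_of_mem hH h', mul_zero]
    rw [deleteP_of_notMem hH h, deleteP_of_notMem hH h']
    exact (Toeplitz.univ (E.delete H hH)).orthogonal _ _ fun h => hvw (congrArg Subtype.val h)
  star_mul_self e := by
    by_cases h : E.s e ∈ H
    · rw [deleteP_of_mem hH h, deleteS_of_mem hH h, mul_zero]
    · rw [deleteP_of_notMem hH h, deleteS_of_notMem hH h]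
      exact (Toeplitz.univ (E.delete H hH)).star_mul_self _
  sum_le v := by
    classical
    by_cases hv : v ∈ H
    · refine ⟨0, ?_⟩
      rw [deleteP_of_mem hH hv, Finset.sum_eq_zero]
      · rw [sub_zero, mul_zero]
      · intro e he
        rw [Finset.mem_filter] at he
        rw [deleteS_of_mem hH, zero_mul]
        by_contra hs
        exact hH.r_notMem hs (he.2 ▸ hv)
    · obtain ⟨b, hb⟩ := (Toeplitz.univ (E.delete H hH)).sum_le ⟨v, hv⟩
      refine ⟨b, ?_⟩
      rw [deleteP_of_notMem hH hv, ← hb]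
      congr 1
      symm
      refine Finset.sum_of_injOn (fun e : (E.delete H hH).Edge => e.1)
        Subtype.val_injective.injOn ?_ ?_ ?_
      · intro e he
        rw [Finset.mem_coe, Finset.mem_filter] at he ⊢
        exact ⟨Finset.mem_univ _, congrArg Subtype.val he.2⟩
      · intro e he hne
        rw [deleteS_of_mem hH, zero_mul]
        by_contra hs
        refine hne ⟨⟨e, hs⟩, ?_, rfl⟩
        rw [Finset.mem_filter] at he
        exact Finset.mem_coe.2 (Finset.mem_filter.2 ⟨Finset.mem_univ _, Subtype.ext he.2⟩)
      · intro e he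
        rw [deleteS_of_notMem hH e.2]
        rfl

end Delete

/-- The quotient map `TC*(E) → TC*(E \ H)` for a hereditary set `H`. -/
def toDelete (E : FinGraph) (H : Set E.V) (hH : E.IsHereditary H) :
    Toeplitz E →⋆ₙₐ[ℂ] Toeplitz (E.delete H hH) :=
  Toeplitz.lift (deleteFamily hH)

/-! ## States and KMS states -/

section States

variable {A B : Type*} [NonUnitalCStarAlgebra A] [NonUnitalCStarAlgebra B]

/-- A state: a positive linear functional of norm one. -/
def IsState (φ : StrongDual ℂ A) : Prop := (∀ a : A, 0 ≤ φ (star a * a)) ∧ ‖φ‖ = 1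

/-- The functional `φ` factors through a state of `B` along `π : A → B`. -/
def FactorsThrough (φ : StrongDual ℂ A) (π : A →⋆ₙₐ[ℂ] B) : Prop :=
  ∃ ψ : StrongDual ℂ B, IsState ψ ∧ ∀ a, φ a = ψ (π a)

/-- `f` is an extension of `t ↦ α_t(a)` to an entire function, written `z ↦ α_z(a)`. (The element
`a` is called analytic for `α` if such an extension exists; it is then unique.) -/
def IsAnalyticExtension (α : ℝ → A → A) (a : A) (f : ℂ → A) : Prop :=
  Differentiable ℂ f ∧ ∀ t : ℝ, f t = α t a

/-- A KMS state at inverse temperature `β`: a state with `φ(ab) = φ(b α_{iβ}(a))` for all analytic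
elements `a`, `b`. -/
def IsKMSState (α : ℝ → A → A) (β : ℝ) (φ : StrongDual ℂ A) : Prop :=
  IsState φ ∧ ∀ (a b : A) (f g : ℂ → A), IsAnalyticExtension α a f → IsAnalyticExtension α b g →
    φ (a * b) = φ (b * f (Complex.I * β))

end States

/-- The set of KMS states of `(TC*(E), α)` at inverse temperature `β`. -/
def kmsStates (E : FinGraph) (β : ℝ) : Set (StrongDual ℂ (Toeplitz E)) :=
  {φ | IsKMSState (fun t a => Toeplitz.dynamics t a) β φ}

/-! ## The dumbbell graph -/

/-- The vertices `v`, `w`. -/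
inductive DumbbellVertex : Type
  | v
  | w

/-- The edges: two loops at `v`, three loops at `w`, and one edge from `w` to `v`. -/
inductive DumbbellEdge : Type
  | loopV₁
  | loopV₂
  | loopW₁
  | loopW₂
  | loopW₃
  | bridge

instance : Fintype DumbbellVertex :=
  open scoped Classical in ⟨{.v, .w}, by intro x; cases x <;> simp⟩

instance : Fintype DumbbellEdge :=
  open scoped Classical in
  ⟨{.loopV₁, .loopV₂, .loopW₁, .loopW₂, .loopW₃, .bridge}, by intro x; cases x <;> simp⟩

/-- The dumbbell graph with two loops at `v`, three loops at `w` and one edge from `w` to `v`. -/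
abbrev dumbbell : FinGraph where
  V := DumbbellVertex
  Edge := DumbbellEdge
  r
    | .loopV₁ | .loopV₂ | .bridge => .v
    | .loopW₁ | .loopW₂ | .loopW₃ => .w
  s
    | .loopV₁ | .loopV₂ => .v
    | .loopW₁ | .loopW₂ | .loopW₃ | .bridge => .w

/-- The vertex `v` of the dumbbell graph. -/
abbrev vtxV : dumbbell.V := DumbbellVertex.v

/-- The vertex `w` of the dumbbell graph. -/
abbrev vtxW : dumbbell.V := DumbbellVertex.w

end GraphAlgebra
end

/-! Put `q = e^{-β}`. Since `α_{iβ}` multiplies `s_e` by `q`, a KMS state satisfies `φ(p_v a) = φ(a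
p_v)` and `φ(s_e a) = q φ(a s_e)`. These relations, with positivity and normalisation, form
`IsGibbs`; for `β ≠ 0` they are equivalent to the KMS condition (`mem_kmsStates_iff`).

The relations reduce every spanning element `s_μ p_v s_ν^*` to a multiple of a vertex projection or
to `0`, so for `0 < q ≠ 1` the state is determined by the vector `m = (φ(p_x))_x` (`IsGibbs.ext`).
As `φ(s_e s_e^*) = q φ(p_{s(e)})`, positivity at the gap projections says `m ≥ q A m`, and `φ`
factors through `C*(E)` exactly when `m = q A m` (`IsGibbs.factorsThrough_iff`).

For the dumbbell `m = (1 - t, t)` with `t = φ(p_w)`, and the inequalities read `t (1 - 3q) ≥ 0` and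
`t (1 - q) ≤ 1 - 2q`. If `q > 1/3` the first forces `t = 0`, and the second then requires `q ≤ 1/2`.
If `q ≤ 1/3` they say `0 ≤ t ≤ T` with `T = (1 - 2q)/(1 - q)`. Equality in both occurs only for `q =
1/2`, `t = 0` and for `q = 1/3`, `t = T = 1/2`.

It remains to realise the endpoints `t = 0` and `t = T`; convex combinations give the rest. On the
`ℓ²`-space of the paths with source `x`, the normalised trace with weights `q^|l|` is a Gibbs
functional that vanishes at the gap projections of all vertices other than `x` (`exists_isGibbs`),
provided that the weights are summable. Source `w` gives `t = T` for `q < 1/3`. The graph with `w`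
deleted gives, by pull-back, `t = 0` for `q < 1/2`. The critical values `q = 1/3` and `q = 1/2` are
reached by weak-* limits (`exists_isGibbs_limit`). -/

noncomputable section

namespace GraphAlgebra

/-! ## Positive functionals -/

section Positive

open scoped ComplexConjugate

variable {A : Type*} [NonUnitalCStarAlgebra A] {φ : StrongDual ℂ A}

/-- A positive functional induces a hermitian form. -/
theorem conj_apply_star_mul (hφ : ∀ a : A, 0 ≤ φ (star a * a)) (x y : A) :
    conj (φ (star x * y)) = φ (star y * x) := by
  have him : ∀ a : A, (φ (star a * a)).im = 0 := fun a =>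
    (Complex.nonneg_iff.1 (hφ a)).2.symm
  -- Polarisation: reality of the form at `x + y` compares the imaginary parts, reality at `x + i y`
  -- the real parts.
  have h1 := him (x + y)
  have h2 := him (x + Complex.I • y)
  simp only [star_add, star_smul, add_mul, mul_add, smul_mul_assoc, mul_smul_comm, map_add,
    map_smul, smul_eq_mul, Complex.add_im, him] at h1 h2
  simp only [Complex.star_def, Complex.conj_I, Complex.mul_im, Complex.mul_re, Complex.neg_im,
    Complex.neg_re, Complex.I_re, Complex.I_im, him] at h2
  apply Complex.ext
  · simp only [Complex.conj_re]; linarith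
  · simp only [Complex.conj_im]; linarith

/-- The Cauchy-Schwarz inequality for a positive functional. -/
theorem norm_sq_apply_star_mul_le (hφ : ∀ a : A, 0 ≤ φ (star a * a)) (x y : A) :
    ‖φ (star x * y)‖ * ‖φ (star x * y)‖ ≤ (φ (star x * x)).re * (φ (star y * y)).re := by
  let c : PreInnerProductSpace.Core ℂ A :=
    { inner := fun x y => φ (star x * y)
      conj_inner_symm := fun x y => conj_apply_star_mul hφ y x
      re_inner_nonneg := fun x => (Complex.nonneg_iff.1 (hφ x)).1
      add_left := fun x y z => by rw [star_add, add_mul, map_add]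
      smul_left := fun x y r => by
        rw [star_smul, smul_mul_assoc, map_smul, smul_eq_mul, Complex.star_def] }
  have h := @InnerProductSpace.Core.inner_mul_inner_self_le ℂ A _ _ _ c x y
  have h' : ‖φ (star y * x)‖ = ‖φ (star x * y)‖ := by
    rw [← conj_apply_star_mul hφ x y, RCLike.norm_conj]
  change ‖φ (star x * y)‖ * ‖φ (star y * x)‖ ≤ _ at h
  rwa [h'] at h

/-- By Cauchy-Schwarz, a null vector of the form is orthogonal to everything. Applied to gap
projections, it turns `φ(gap) = 0` into `φ(gap * b) = 0`. -/
theorem apply_eq_zero_of_left (hφ : ∀ a : A, 0 ≤ φ (star a * a)) {x : A}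
    (hx : φ (star x * x) = 0) (y : A) : φ (star x * y) = 0 := by
  have h := norm_sq_apply_star_mul_le hφ x y
  rw [hx, Complex.zero_re, zero_mul] at h
  exact norm_eq_zero.1 (mul_self_eq_zero.1 (le_antisymm h (mul_self_nonneg _)))

theorem star_eq_of_unit {u : A} (hu : ∀ a, u * a = a) : star u = u :=
  calc star u = star (u * star u) := by rw [star_mul, star_star, hu]
    _ = u := by rw [hu, star_star]

/-- Hermitian symmetry of the form with the unit in one slot. -/
theorem apply_star (hφ : ∀ a : A, 0 ≤ φ (star a * a)) {u : A} (hu : ∀ a, u * a = a) (a : A) :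
    φ (star a) = conj (φ a) := by
  have hu' := star_eq_of_unit hu
  have h := conj_apply_star_mul hφ u a
  rw [hu', hu] at h
  rw [h, ← hu', ← star_mul, hu]

/-- In a C*-algebra with unit `u`, the states are the positive functionals with `φ u = 1`. -/
theorem isState_iff {u : A} (hu : ∀ a, u * a = a) (hu0 : u ≠ 0) :
    IsState φ ↔ (∀ a : A, 0 ≤ φ (star a * a)) ∧ φ u = 1 := by
  have hu' := star_eq_of_unit hu
  have hn : ‖u‖ = 1 := by
    have h := CStarRing.norm_star_mul_self (x := u)
    rw [hu', hu] at h
    have h0 : ‖u‖ ≠ 0 := norm_ne_zero_iff.2 hu0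
    exact mul_left_cancel₀ h0 (by rw [← h, mul_one])
  refine and_congr_right fun hφ => ?_
  have hpos := hφ u
  rw [hu', hu] at hpos
  obtain ⟨hre, him⟩ := Complex.nonneg_iff.1 hpos
  have hval : φ u = ((φ u).re : ℂ) := Complex.ext rfl (by simpa using him.symm)
  have hle : (φ u).re ≤ ‖φ‖ := by
    calc (φ u).re ≤ ‖φ u‖ := Complex.re_le_norm _
      _ ≤ ‖φ‖ * ‖u‖ := φ.le_opNorm u
      _ = ‖φ‖ := by rw [hn, mul_one]
  have hge : ‖φ‖ ≤ (φ u).re := by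
    -- Cauchy-Schwarz against the unit: `|φ(a)|² ≤ φ(u) φ(a*a) ≤ φ(u) ‖φ‖ ‖a‖²`, hence `‖φ‖² ≤ φ(u)
    -- ‖φ‖`.
    have hsq : ‖φ‖ ≤ √((φ u).re * ‖φ‖) := by
      refine φ.opNorm_le_bound (Real.sqrt_nonneg _) fun a => ?_
      have h := norm_sq_apply_star_mul_le hφ u a
      rw [hu', hu, hu] at h
      have h2 : (φ (star a * a)).re ≤ ‖φ‖ * (‖a‖ * ‖a‖) := by
        rw [← CStarRing.norm_star_mul_self]
        exact (Complex.re_le_norm _).trans (φ.le_opNorm _)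
      refine abs_le_of_sq_le_sq' ?_ (by positivity) |>.2
      rw [mul_pow, Real.sq_sqrt (by positivity), sq, sq]
      nlinarith
    have h := mul_self_le_mul_self (norm_nonneg φ) hsq
    rw [Real.mul_self_sqrt (by positivity)] at h
    rcases (norm_nonneg φ).eq_or_lt with h0 | h0
    · rw [← h0]; exact hre
    · exact le_of_mul_le_mul_right h h0
  have heq : ‖φ‖ = (φ u).re := le_antisymm hge hle
  constructor
  · intro h
    rw [hval, ← heq, h, Complex.ofReal_one]
  · intro h
    rw [heq, h, Complex.one_re]

end Positive

/-! ## The unit and the homogeneous elements -/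

namespace Toeplitz

variable {E : FinGraph}

/-! ### Relations between the generators -/

theorem p_mul_self (v : E.V) : (p v : Toeplitz E) * p v = p v :=
  ((univ E).isStarProjection v).isIdempotentElem.eq

theorem star_p (v : E.V) : star (p v : Toeplitz E) = p v :=
  ((univ E).isStarProjection v).isSelfAdjoint.star_eq

theorem p_mul_p_of_ne {v w : E.V} (h : v ≠ w) : (p v : Toeplitz E) * p w = 0 :=
  (univ E).orthogonal v w h

theorem star_s_mul_s (e : E.Edge) : star (s e : Toeplitz E) * s e = p (E.s e) :=
  (univ E).star_mul_self e

/-- By the C*-identity it suffices that `(s p - s)^* (s p - s)` vanishes, and this expands to `p - p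
- p + p`. -/
theorem s_mul_p (e : E.Edge) : (s e : Toeplitz E) * p (E.s e) = s e := by
  have h : star (s e * p (E.s e) - s e : Toeplitz E) * (s e * p (E.s e) - s e) = 0 := by
    have h1 := star_s_mul_s e
    have h2 := p_mul_self (E.s e)
    simp only [star_sub, star_mul, star_p, mul_sub, sub_mul]
    simp only [mul_assoc]
    simp only [← mul_assoc (star (s e)), h1, h2]
    simp
  exact sub_eq_zero.1 ((CStarRing.star_mul_self_eq_zero_iff _).1 h)

theorem s_mul_star_s_mul_s (e : E.Edge) : (s e * star (s e) : Toeplitz E) * s e = s e := by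
  rw [mul_assoc, star_s_mul_s, s_mul_p]

open scoped Classical in
theorem sum_s_mul_star_s_le [PartialOrder (Toeplitz E)] [StarOrderedRing (Toeplitz E)] (v : E.V) :
    ∑ f with E.r f = v, (s f : Toeplitz E) * star (s f) ≤ p v := by
  obtain ⟨b, hb⟩ := (univ E).sum_le v
  rw [← sub_nonneg]
  convert star_mul_self_nonneg b
  rw [← hb]
  congr!

theorem isStarProjection_s_mul_star_s (e : E.Edge) :
    IsStarProjection (s e * star (s e) : Toeplitz E) := (univ E).isStarProjection_range e

/-- The range projection `s_e s_e^*` is one summand of a sum below `p_{r(e)}`, so `p_{r(e)}` acts as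
the identity on it. -/
theorem p_mul_s (e : E.Edge) : (p (E.r e) : Toeplitz E) * s e = s e := by
  classical
  let _ := CStarAlgebra.spectralOrder (Toeplitz E)
  let _ := CStarAlgebra.spectralOrderedRing (Toeplitz E)
  have hle : (s e * star (s e) : Toeplitz E) ≤ p (E.r e) :=
    (Finset.single_le_sum (f := fun f => (s f * star (s f) : Toeplitz E))
      (fun f _ => (isStarProjection_s_mul_star_s f).nonneg) (by simp)).trans
        (sum_s_mul_star_s_le _)
  have h : p (E.r e) * (s e * star (s e) : Toeplitz E) = s e * star (s e) :=
    ((isStarProjection_s_mul_star_s e).le_iff_mul_eq_right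
      ((univ E).isStarProjection (E.r e))).1 hle
  calc _ = p (E.r e) * (s e * star (s e)) * s e := by rw [mul_assoc, s_mul_star_s_mul_s]
    _ = s e := by rw [h, s_mul_star_s_mul_s]

theorem p_mul_s_of_ne {v : E.V} {e : E.Edge} (h : v ≠ E.r e) : (p v : Toeplitz E) * s e = 0 := by
  rw [← p_mul_s, ← mul_assoc, p_mul_p_of_ne h, zero_mul]

/-- Different ranges are separated by the orthogonal vertex projections. For equal ranges the two
range projections add up to at most `p`; compressing this inequality by `s_e` leaves `-(s_f^* s_e)^*
(s_f^* s_e) ≥ 0`, so `s_f^* s_e = 0`. -/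
theorem star_s_mul_s_of_ne {e f : E.Edge} (hef : e ≠ f) : star (s e : Toeplitz E) * s f = 0 := by
  classical
  rcases ne_or_eq (E.r e) (E.r f) with hr | hr
  · rw [← p_mul_s e, star_mul, star_p, mul_assoc, p_mul_s_of_ne hr, mul_zero]
  let _ := CStarAlgebra.spectralOrder (Toeplitz E)
  let _ := CStarAlgebra.spectralOrderedRing (Toeplitz E)
  have h1 : (s e * star (s e) : Toeplitz E) + s f * star (s f) ≤ p (E.r e) := by
    refine le_trans ?_ (sum_s_mul_star_s_le _)
    rw [← Finset.sum_pair hef (f := fun f => (s f * star (s f) : Toeplitz E))]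
    refine Finset.sum_le_sum_of_subset_of_nonneg (fun g hg => ?_)
      fun f _ _ => (isStarProjection_s_mul_star_s f).nonneg
    rcases Finset.mem_insert.1 hg with rfl | hg
    · simp
    · rw [Finset.mem_singleton.1 hg]; simp [hr]
  have h2 : 0 ≤ star (s e : Toeplitz E) * (p (E.r e) - (s e * star (s e) + s f * star (s f))) *
      s e := star_left_conjugate_nonneg (sub_nonneg.2 h1) _
  have h3 : star (s e : Toeplitz E) * (p (E.r e) - (s e * star (s e) + s f * star (s f))) * s e
      = -(star (star (s f) * s e) * (star (s f) * s e)) := by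
    rw [mul_assoc, sub_mul, add_mul, p_mul_s, s_mul_star_s_mul_s, star_mul, star_star]
    simp only [mul_sub, mul_add, mul_assoc]
    abel
  rw [h3] at h2
  have h4 := le_antisymm (neg_nonneg.1 h2) (star_mul_self_nonneg _)
  have h5 := (CStarRing.star_mul_self_eq_zero_iff _).1 h4
  rw [← star_star (s f), ← star_mul, h5, star_zero]

variable (E) in
/-- The unit `∑ p_v` of `TC*(E)`. -/
def unit : Toeplitz E := ∑ v, p v

theorem star_unit : star (unit E) = unit E := by
  rw [unit, star_sum]
  exact Finset.sum_congr rfl fun v _ => star_p v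

theorem unit_mul_p (v : E.V) : unit E * p v = p v := by
  rw [unit, Finset.sum_mul, Finset.sum_eq_single v, p_mul_self]
  · exact fun w _ h => p_mul_p_of_ne h
  · simp

theorem unit_mul_s (e : E.Edge) : unit E * s e = s e := by
  rw [← p_mul_s e, ← mul_assoc, unit_mul_p]

theorem s_mul_unit (e : E.Edge) : s e * unit E = s e := by
  have h : p (E.s e) * unit E = p (E.s e) := by
    rw [← star_p, ← star_unit, ← star_mul, unit_mul_p]
  rw [← s_mul_p e, mul_assoc, h]

/-- Elements of degree `n` for the gauge action in the `*`-algebra generated by the `p_v` and the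
`s_e`. -/
inductive IsHomogeneous : ℤ → Toeplitz E → Prop
  | p (v : E.V) : IsHomogeneous 0 (p v)
  | s (e : E.Edge) : IsHomogeneous 1 (s e)
  | zero (n : ℤ) : IsHomogeneous n 0
  | add {n : ℤ} {a b : Toeplitz E} : IsHomogeneous n a → IsHomogeneous n b →
      IsHomogeneous n (a + b)
  | smul {n : ℤ} (c : ℂ) {a : Toeplitz E} : IsHomogeneous n a → IsHomogeneous n (c • a)
  | mul {m n : ℤ} {a b : Toeplitz E} : IsHomogeneous m a → IsHomogeneous n b →
      IsHomogeneous (m + n) (a * b)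
  | star {n : ℤ} {a : Toeplitz E} : IsHomogeneous n a → IsHomogeneous (-n) (star a)

/-- Both sides are treated together because the adjoint exchanges them in the induction. -/
theorem IsHomogeneous.unit_mul {n : ℤ} {a : Toeplitz E} (ha : IsHomogeneous n a) :
    unit E * a = a ∧ a * unit E = a := by
  induction ha with
  | p v => exact ⟨unit_mul_p v, by rw [← star_p, ← star_unit, ← star_mul, unit_mul_p]⟩
  | s e => exact ⟨unit_mul_s e, s_mul_unit e⟩
  | zero n => simp
  | add _ _ ha hb => rw [mul_add, add_mul, ha.1, hb.1, ha.2, hb.2]; exact ⟨rfl, rfl⟩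
  | smul c _ ha => rw [mul_smul_comm, smul_mul_assoc, ha.1, ha.2]; exact ⟨rfl, rfl⟩
  | mul _ _ ha hb => rw [← mul_assoc, ha.1, mul_assoc, hb.2]; exact ⟨rfl, rfl⟩
  | star _ ha =>
    rw [← star_unit, ← star_mul, ← star_mul, ha.1, ha.2]
    exact ⟨rfl, rfl⟩

variable (E) in
/-- The span of the homogeneous elements. -/
def homogeneousSpan : Submodule ℂ (Toeplitz E) :=
  Submodule.span ℂ {a | ∃ n, IsHomogeneous n a}

theorem IsHomogeneous.mem_span {n : ℤ} {a : Toeplitz E} (ha : IsHomogeneous n a) :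
    a ∈ homogeneousSpan E := Submodule.subset_span ⟨n, ha⟩

theorem mul_mem_homogeneousSpan {a b : Toeplitz E} (ha : a ∈ homogeneousSpan E)
    (hb : b ∈ homogeneousSpan E) : a * b ∈ homogeneousSpan E := by
  refine Submodule.span_induction₂ (p := fun a b _ _ => a * b ∈ homogeneousSpan E)
    ?_ ?_ ?_ ?_ ?_ ?_ ?_ ha hb
  · rintro a b ⟨m, ha⟩ ⟨n, hb⟩
    exact (ha.mul hb).mem_span
  · intro b _; simp
  · intro a _; simp
  · intro a a' b _ _ _ h h'; rw [add_mul]; exact add_mem h h'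
  · intro a b b' _ _ _ h h'; rw [mul_add]; exact add_mem h h'
  · intro c a b _ _ h; rw [smul_mul_assoc]; exact Submodule.smul_mem _ c h
  · intro c a b _ _ h; rw [mul_smul_comm]; exact Submodule.smul_mem _ c h

theorem star_mem_homogeneousSpan {a : Toeplitz E} (ha : a ∈ homogeneousSpan E) :
    star a ∈ homogeneousSpan E := by
  refine Submodule.span_induction (p := fun a _ => star a ∈ homogeneousSpan E) ?_ ?_ ?_ ?_ ha
  · rintro a ⟨n, ha⟩
    exact ha.star.mem_span
  · simp
  · intro a b _ _ h h'; rw [star_add]; exact add_mem h h'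
  · intro c a _ h; rw [star_smul]; exact Submodule.smul_mem _ _ h

/-- The homogeneous span is a `*`-subalgebra that contains the generators, so it contains all
`*`-polynomials and is dense. -/
theorem incl_mem_homogeneousSpan (x : PreToeplitz E) : incl x ∈ homogeneousSpan E := by
  induction x using Quotient.inductionOn with | _ x
  change incl (PreToeplitz.mk x) ∈ _
  induction x with
  | vert v => exact (IsHomogeneous.p v).mem_span
  | edge e => exact (IsHomogeneous.s e).mem_span
  | zero =>
    change incl 0 ∈ _
    rw [map_zero]; exact zero_mem _
  | add x y hx hy =>
    change incl (PreToeplitz.mk x + PreToeplitz.mk y) ∈ _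
    rw [map_add]; exact add_mem hx hy
  | neg x hx =>
    change incl (-PreToeplitz.mk x) ∈ _
    rw [map_neg]; exact neg_mem hx
  | smul c x hx =>
    change incl (c • PreToeplitz.mk x) ∈ _
    rw [map_smul]; exact Submodule.smul_mem _ c hx
  | mul x y hx hy =>
    change incl (PreToeplitz.mk x * PreToeplitz.mk y) ∈ _
    rw [incl_mul]; exact mul_mem_homogeneousSpan hx hy
  | star x hx =>
    change incl (star (PreToeplitz.mk x)) ∈ _
    rw [incl_star]; exact star_mem_homogeneousSpan hx

/-- A closed linear condition holds everywhere if it holds at homogeneous elements. -/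
theorem eq_of_homogeneous {B : Type*} [NormedAddCommGroup B] [NormedSpace ℂ B]
    {f g : Toeplitz E →L[ℂ] B} (h : ∀ n a, IsHomogeneous n a → f a = g a) : f = g := by
  ext a
  induction a using induction_on with
  | hp => exact isClosed_eq f.continuous g.continuous
  | ih x =>
    have : homogeneousSpan E ≤ LinearMap.eqLocus f.toLinearMap g.toLinearMap :=
      Submodule.span_le.2 fun a ⟨n, ha⟩ => h n a ha
    exact this (incl_mem_homogeneousSpan x)

theorem unit_mul (a : Toeplitz E) : unit E * a = a := by
  have : ContinuousLinearMap.mul ℂ (Toeplitz E) (unit E) = ContinuousLinearMap.id ℂ _ :=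
    eq_of_homogeneous fun n a ha => ha.unit_mul.1
  exact congrArg (fun f : Toeplitz E →L[ℂ] Toeplitz E => f a) this

theorem mul_unit (a : Toeplitz E) : a * unit E = a := by
  rw [← star_star a, ← star_unit, ← star_mul, unit_mul]

theorem isHomogeneous_unit : IsHomogeneous 0 (unit E) :=
  Finset.sum_induction _ (IsHomogeneous 0) (fun _ _ => .add) (.zero 0) fun v _ => .p v

/-! ### The dynamics on homogeneous elements -/

theorem dynamics_p (t : ℝ) (v : E.V) : dynamics t (p v) = p v := lift_p _ v

theorem dynamics_s (t : ℝ) (e : E.Edge) :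
    dynamics t (s e) = Complex.exp (Complex.I * t) • s e := by
  refine (lift_s _ e).trans ?_
  change (Circle.exp t : ℂ) • s e = _
  rw [Circle.coe_exp, mul_comm]

theorem IsHomogeneous.dynamics_apply {n : ℤ} {a : Toeplitz E} (ha : IsHomogeneous n a) (t : ℝ) :
    dynamics t a = Complex.exp (Complex.I * t * n) • a := by
  induction ha with
  | p v => simp [dynamics_p]
  | s e => simp [dynamics_s]
  | zero n => simp
  | add _ _ ha hb => rw [map_add, ha, hb, smul_add]
  | smul c _ ha => rw [map_smul, ha, smul_comm]
  | @mul m n a b _ _ ha hb =>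
    rw [map_mul, ha, hb, smul_mul_smul_comm, ← Complex.exp_add]
    congr 2
    push_cast
    ring
  | @star n a _ ha =>
    rw [map_star, ha, star_smul]
    congr 1
    rw [Complex.star_def, ← Complex.exp_conj]
    congr 1
    simp

/-- Homogeneous elements are eigenvectors of `α`, hence analytic; at `z = iβ` the factor is `e^{-βn}
= q^n`. -/
theorem IsHomogeneous.isAnalyticExtension {n : ℤ} {a : Toeplitz E} (ha : IsHomogeneous n a) :
    IsAnalyticExtension (fun t a => dynamics t a) a
      fun z => Complex.exp (Complex.I * z * n) • a := by
  refine ⟨?_, fun t => (ha.dynamics_apply t).symm⟩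
  fun_prop

end Toeplitz

/-! ## KMS functionals in terms of the generators -/

section Gibbs

open Toeplitz
open scoped ComplexConjugate

variable {E : FinGraph} {q : ℝ} {φ ψ : StrongDual ℂ (Toeplitz E)}

/-- The KMS condition at the generators, with `q = e^{-β}`. -/
structure IsGibbs (q : ℝ) (φ : StrongDual ℂ (Toeplitz E)) : Prop where
  nonneg : ∀ a, 0 ≤ φ (star a * a)
  map_unit : φ (unit E) = 1
  map_p_mul : ∀ v a, φ (p v * a) = φ (a * p v)
  map_s_mul : ∀ e a, φ (s e * a) = q * φ (a * s e)

theorem IsGibbs.unit_ne_zero (hφ : IsGibbs q φ) : unit E ≠ 0 := fun h => by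
  simpa [h] using hφ.map_unit

theorem IsState.unit_ne_zero (hφ : IsState φ) : unit E ≠ 0 := fun h => by
  have h0 : φ = 0 := by
    ext a
    rw [← unit_mul a, h, zero_mul, map_zero]
    rfl
  simpa [h0] using hφ.2

theorem IsState.map_unit (hφ : IsState φ) : φ (unit E) = 1 :=
  ((isState_iff unit_mul hφ.unit_ne_zero).1 hφ).2

theorem IsGibbs.isState (hφ : IsGibbs q φ) : IsState φ :=
  (isState_iff unit_mul hφ.unit_ne_zero).2 ⟨hφ.nonneg, hφ.map_unit⟩

/-- The commutation rule propagates from the generators: factors of a product are moved around one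
at a time, and the adjoint is handled by `φ(a^*) = conj φ(a)`, where `q` being real keeps the
scalar. -/
theorem IsGibbs.map_homogeneous_mul (hφ : IsGibbs q φ) (hq : q ≠ 0) {n : ℤ} {b : Toeplitz E}
    (hb : IsHomogeneous n b) (a : Toeplitz E) : φ (b * a) = (q : ℂ) ^ n * φ (a * b) := by
  have hq' : (q : ℂ) ≠ 0 := Complex.ofReal_ne_zero.2 hq
  induction hb generalizing a with
  | p v => rw [zpow_zero, one_mul, hφ.map_p_mul]
  | s e => rw [zpow_one, hφ.map_s_mul]
  | zero n => simp
  | add _ _ hb hc => rw [add_mul, mul_add, map_add, map_add, hb, hc, mul_add]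
  | smul c _ hb =>
    rw [smul_mul_assoc, mul_smul_comm, map_smul, map_smul, hb, smul_eq_mul, smul_eq_mul]
    ring
  | mul _ _ hb hc => rw [mul_assoc, hb, mul_assoc, hc, mul_assoc, zpow_add₀ hq', mul_assoc]
  | @star n b _ hb =>
    have h1 : star b * a = star (star a * b) := by rw [star_mul, star_star]
    have h2 : a * star b = star (b * star a) := by rw [star_mul, star_star]
    rw [h1, h2, apply_star hφ.nonneg unit_mul, apply_star hφ.nonneg unit_mul, hb,
      map_mul (starRingEnd ℂ), map_zpow₀, Complex.conj_ofReal, ← mul_assoc, ← zpow_add₀ hq', neg_add_cancel,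
      zpow_zero, one_mul]

/-- Commuting `b` with the unit gives `φ(b) = q^n φ(b)`, and `q^n ≠ 1` for positive `q ≠ 1`. -/
theorem IsGibbs.map_homogeneous_eq_zero (hφ : IsGibbs q φ) (hq : 0 < q) (hq1 : q ≠ 1) {n : ℤ}
    (hn : n ≠ 0) {b : Toeplitz E} (hb : IsHomogeneous n b) : φ b = 0 := by
  have h := hφ.map_homogeneous_mul hq.ne' hb (unit E)
  rw [mul_unit, unit_mul] at h
  have h1 : (q : ℂ) ^ n ≠ 1 := by
    rw [← Complex.ofReal_zpow, Ne, Complex.ofReal_eq_one]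
    intro h
    rcases (zpow_eq_one_iff_of_ne_zero₀ hn).1 h with h | h
    · exact hq1 h
    · linarith [h.1]
  have h2 : (1 - (q : ℂ) ^ n) * φ b = 0 := by rw [sub_mul, one_mul, ← h, sub_self]
  exact (mul_eq_zero.1 h2).resolve_left (sub_ne_zero.2 h1.symm)

/-- `a ↦ π a` as a continuous linear map. -/
def homL {A B : Type*} [NonUnitalCStarAlgebra A] [NonUnitalCStarAlgebra B]
    (π : A →⋆ₙₐ[ℂ] B) : A →L[ℂ] B :=
  LinearMap.mkContinuous
    { toFun := π
      map_add' := map_add π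
      map_smul' := map_smul π } 1 fun a => by
        simpa using NonUnitalStarAlgHom.norm_apply_le π a

theorem homL_apply {A B : Type*} [NonUnitalCStarAlgebra A] [NonUnitalCStarAlgebra B]
    (π : A →⋆ₙₐ[ℂ] B) (a : A) : homL π a = π a := rfl

/-- Only degree `0` contributes to `φ`, and there `α_t` is the identity. -/
theorem IsGibbs.map_dynamics (hφ : IsGibbs q φ) (hq : 0 < q) (hq1 : q ≠ 1) (t : ℝ)
    (a : Toeplitz E) : φ (dynamics t a) = φ a := by
  have : φ.comp (homL (dynamics t)) = φ := by
    refine eq_of_homogeneous fun n b hb => ?_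
    rw [ContinuousLinearMap.comp_apply, homL_apply, hb.dynamics_apply, map_smul]
    rcases eq_or_ne n 0 with rfl | hn
    · simp
    · rw [hφ.map_homogeneous_eq_zero hq hq1 hn hb, smul_zero]
  exact congrArg (fun f : StrongDual ℂ (Toeplitz E) => f a) this

/-- An entire function that is constant on the reals is constant. -/
theorem eq_of_forall_real {g : ℂ → ℂ} (hg : Differentiable ℂ g) {c : ℂ}
    (h : ∀ t : ℝ, g t = c) (z : ℂ) : g z = c := by
  have : g = fun _ => c := by
    refine AnalyticOnNhd.eq_of_frequently_eq (z₀ := 0)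
      (hg.differentiableOn.analyticOnNhd isOpen_univ) analyticOnNhd_const ?_
    -- The identity theorem needs agreement at points accumulating at `0`; the nonzero reals provide
    -- them.
    have hmap : Filter.Tendsto (fun t : ℝ => (t : ℂ)) (nhdsWithin 0 {0}ᶜ)
        (nhdsWithin 0 {0}ᶜ) := by
      refine tendsto_nhdsWithin_iff.2 ⟨?_, ?_⟩
      · exact (Complex.continuous_ofReal.tendsto' 0 0 Complex.ofReal_zero).mono_left
          nhdsWithin_le_nhds
      · filter_upwards [self_mem_nhdsWithin] with t ht
        simpa using ht
    exact hmap.frequently (Filter.Frequently.of_forall h)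
  rw [this]

theorem exp_neg_zpow (β : ℝ) (n : ℤ) :
    ((Real.exp (-β) : ℝ) : ℂ) ^ n = Complex.exp (Complex.I * (Complex.I * β) * n) := by
  rw [Complex.ofReal_exp, ← Complex.exp_int_mul]
  congr 1
  rw [← mul_assoc Complex.I, Complex.I_mul_I]
  push_cast
  ring

/-- By density the second factor may be taken homogeneous, while the first remains an arbitrary
analytic element with extension `f`. The condition `β ≠ 0` makes `q ≠ 1`, which gives invariance of
`φ` under the dynamics. -/
theorem IsGibbs.mem_kmsStates {β : ℝ} (hβ : β ≠ 0) (hφ : IsGibbs (Real.exp (-β)) φ) :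
    φ ∈ kmsStates E β := by
  have hq1 : Real.exp (-β) ≠ 1 := by simpa using hβ
  refine ⟨hφ.isState, fun a b f _ hf _ => ?_⟩
  have key : φ.comp (ContinuousLinearMap.mul ℂ (Toeplitz E) a) =
      φ.comp ((ContinuousLinearMap.mul ℂ (Toeplitz E)).flip (f (Complex.I * β))) := by
    refine eq_of_homogeneous fun n b hb => ?_
    change φ (a * b) = φ (b * f (Complex.I * β))
    rw [hφ.map_homogeneous_mul (Real.exp_pos _).ne' hb, exp_neg_zpow]
    symm
    -- For real `z = t` this function is `φ(α_t(a) α_t(b)) = φ(ab)`, so it is constant; its value at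
    -- `iβ` is `q^n φ(f(iβ) b) = φ(b f(iβ))`.
    refine eq_of_forall_real (g := fun z => Complex.exp (Complex.I * z * n) * φ (f z * b))
      ?_ (fun t => ?_) _
    · have h1 : Differentiable ℂ fun z => φ (f z * b) :=
        (φ.comp ((ContinuousLinearMap.mul ℂ (Toeplitz E)).flip b)).differentiable.comp hf.1
      exact Differentiable.mul (by fun_prop) h1
    · have h1 : dynamics t b = Complex.exp (Complex.I * t * n) • b := hb.dynamics_apply t
      rw [hf.2, ← smul_eq_mul, ← φ.map_smul, ← mul_smul_comm, ← h1, ← map_mul,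
        hφ.map_dynamics (Real.exp_pos _) hq1]
  exact congrArg (fun g : StrongDual ℂ (Toeplitz E) => g b) key

/-- The KMS condition is tested on pairs of homogeneous elements, whose analytic extensions are
explicit. This direction holds for every `β`, including `0`. -/
theorem isGibbs_of_mem_kmsStates {β : ℝ} (hφ : φ ∈ kmsStates E β) :
    IsGibbs (Real.exp (-β)) φ := by
  obtain ⟨hs, hk⟩ := hφ
  have key : ∀ n b a, IsHomogeneous n b →
      φ (b * a) = ((Real.exp (-β) : ℝ) : ℂ) ^ n * φ (a * b) := by
    intro n b a hb
    have : φ.comp (ContinuousLinearMap.mul ℂ (Toeplitz E) b) = ((Real.exp (-β) : ℝ) : ℂ) ^ n •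
        φ.comp ((ContinuousLinearMap.mul ℂ (Toeplitz E)).flip b) := by
      refine eq_of_homogeneous fun m a ha => ?_
      change φ (b * a) = ((Real.exp (-β) : ℝ) : ℂ) ^ n • φ (a * b)
      rw [hk b a _ _ hb.isAnalyticExtension ha.isAnalyticExtension, mul_smul_comm,
        φ.map_smul, exp_neg_zpow]
    exact congrArg (fun g : StrongDual ℂ (Toeplitz E) => g a) this
  exact ⟨hs.1, hs.map_unit, fun v a => by simpa using key 0 _ a (.p v),
    fun e a => by simpa using key 1 _ a (.s e)⟩

theorem mem_kmsStates_iff {β : ℝ} (hβ : β ≠ 0) :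
    φ ∈ kmsStates E β ↔ IsGibbs (Real.exp (-β)) φ :=
  ⟨isGibbs_of_mem_kmsStates, IsGibbs.mem_kmsStates hβ⟩

/-! ## Values at the vertex projections -/

theorem IsGibbs.map_p_nonneg (hφ : IsGibbs q φ) (v : E.V) : 0 ≤ φ (p v) := by
  simpa [star_p, p_mul_self] using hφ.nonneg (p v)

theorem IsGibbs.sum_map_p (hφ : IsGibbs q φ) : ∑ v, φ (p v) = 1 := by
  rw [← hφ.map_unit, unit, map_sum]

theorem gap_mul_self (v : E.V) : (univ E).gap v * (univ E).gap v = (univ E).gap v :=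
  ((univ E).isStarProjection_gap v).isIdempotentElem.eq

theorem star_gap (v : E.V) : star ((univ E).gap v) = (univ E).gap v :=
  ((univ E).isStarProjection_gap v).isSelfAdjoint.star_eq

-- The value at the gap projection is the `v`-entry of `m - q A m`, because `φ(s_e s_e^*) = q
-- φ(s_e^* s_e) = q φ(p_{s(e)})`.
open scoped Classical in
theorem IsGibbs.map_gap (hφ : IsGibbs q φ) (v : E.V) :
    φ ((univ E).gap v) = φ (p v) - q * ∑ e with E.r e = v, φ (p (E.s e)) := by
  rw [TCKFamily.gap, map_sub, map_sum, Finset.mul_sum]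
  congr 1
  refine Finset.sum_congr rfl fun e _ => ?_
  change φ (s e * star (s e)) = _
  rw [hφ.map_s_mul, star_s_mul_s]

theorem IsGibbs.map_gap_nonneg (hφ : IsGibbs q φ) (v : E.V) : 0 ≤ φ ((univ E).gap v) := by
  simpa [star_gap, gap_mul_self] using hφ.nonneg ((univ E).gap v)

/-! ## Uniqueness -/

/-- The product `s_μ` of the `s_e` along a list of edges. -/
def sPath : List E.Edge → Toeplitz E
  | [] => unit E
  | e :: μ => s e * sPath μ

theorem isHomogeneous_sPath (μ : List E.Edge) : IsHomogeneous μ.length (sPath μ) := by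
  induction μ with
  | nil => exact isHomogeneous_unit
  | cons e μ ih =>
    rw [List.length_cons, Nat.cast_succ, add_comm]
    exact (IsHomogeneous.s e).mul ih

theorem sPath_append (μ ν : List E.Edge) : sPath (μ ++ ν) = sPath μ * sPath ν := by
  induction μ with
  | nil => exact (unit_mul _).symm
  | cons e μ ih => rw [List.cons_append, sPath, sPath, ih, mul_assoc]

/-- The spanning elements `s_μ p_v s_ν^*`. -/
def matrixUnit (μ : List E.Edge) (v : E.V) (ν : List E.Edge) : Toeplitz E :=
  sPath μ * p v * star (sPath ν)

/-- The lists need not be composable paths, so some of these elements are zero; the dichotomy avoids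
any case analysis of composability. -/
theorem p_mul_matrixUnit (x : E.V) (μ : List E.Edge) (v : E.V) (ν : List E.Edge) :
    p x * matrixUnit μ v ν = matrixUnit μ v ν ∨ p x * matrixUnit μ v ν = 0 := by
  cases μ with
  | nil =>
    simp only [matrixUnit, sPath, unit_mul, ← mul_assoc]
    rcases eq_or_ne x v with rfl | h
    · left; rw [p_mul_self]
    · right; rw [p_mul_p_of_ne h, zero_mul]
  | cons e μ =>
    simp only [matrixUnit, sPath, ← mul_assoc]
    rcases eq_or_ne x (E.r e) with rfl | h
    · left; rw [p_mul_s]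
    · right; rw [p_mul_s_of_ne h]; simp

/-- Either `s_e^*` cancels the first edge of `μ`, or it annihilates the element, or `μ` is empty and
`s_e^*` is absorbed on the right, at the far end of `ν`. -/
theorem star_s_mul_matrixUnit (e : E.Edge) (μ : List E.Edge) (v : E.V) (ν : List E.Edge) :
    star (s e) * matrixUnit μ v ν = 0 ∨
      ∃ μ' v' ν', star (s e) * matrixUnit μ v ν = matrixUnit μ' v' ν' := by
  cases μ with
  | nil =>
    rcases eq_or_ne v (E.r e) with rfl | h
    · right
      refine ⟨[], E.s e, ν ++ [e], ?_⟩
      simp only [matrixUnit, sPath, sPath_append, unit_mul, mul_unit, star_mul, ← mul_assoc]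
      congr 1
      rw [← star_p (E.r e), ← star_mul, p_mul_s, ← star_p (E.s e), ← star_mul, s_mul_p]
    · left
      simp only [matrixUnit, sPath, unit_mul, ← mul_assoc]
      rw [← star_p v, ← star_mul, p_mul_s_of_ne h, star_zero, zero_mul]
  | cons f μ =>
    have h0 : star (s e) * matrixUnit (f :: μ) v ν = star (s e) * s f * matrixUnit μ v ν := by
      simp only [matrixUnit, sPath, mul_assoc]
    rw [h0]
    rcases eq_or_ne e f with rfl | h
    · rw [star_s_mul_s]
      rcases p_mul_matrixUnit (E.s e) μ v ν with h | h
      · exact .inr ⟨μ, v, ν, h⟩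
      · exact .inl h
    · exact .inl (by rw [star_s_mul_s_of_ne h, zero_mul])

/-- Homogeneous elements are in the linear span of the `s_μ p_v s_ν^*`. -/
theorem mem_span_matrixUnit {n : ℤ} {b : Toeplitz E} (hb : IsHomogeneous n b) :
    b ∈ Submodule.span ℂ {x | ∃ μ v ν, x = matrixUnit (E := E) μ v ν} := by
  set M := Submodule.span ℂ {x | ∃ μ v ν, x = matrixUnit (E := E) μ v ν}
  have hM : ∀ μ v ν, matrixUnit (E := E) μ v ν ∈ M := fun μ v ν =>
    Submodule.subset_span ⟨μ, v, ν, rfl⟩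
  have ext : ∀ c : Toeplitz E, (∀ μ v ν, c * matrixUnit μ v ν ∈ M) → ∀ x ∈ M, c * x ∈ M := by
    intro c hc x hx
    refine Submodule.span_induction (p := fun x _ => c * x ∈ M) ?_ ?_ ?_ ?_ hx
    · rintro _ ⟨μ, v, ν, rfl⟩; exact hc μ v ν
    · simp
    · intro a b _ _ ha hb; rw [mul_add]; exact add_mem ha hb
    · intro k a _ ha; rw [mul_smul_comm]; exact M.smul_mem k ha
  -- Left multiplication by `b` and by `b^*` preserves the span; including `b^*` lets the induction
  -- pass through adjoints.
  have key : ∀ x ∈ M, b * x ∈ M ∧ star b * x ∈ M := by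
    induction hb with
    | p v =>
      have h := ext (p v) fun μ w ν => by
        rcases p_mul_matrixUnit v μ w ν with h | h <;> rw [h]
        exacts [hM _ _ _, zero_mem _]
      intro x hx
      rw [star_p]
      exact ⟨h x hx, h x hx⟩
    | s e =>
      refine fun x hx => ⟨ext (s e) (fun μ v ν => ?_) x hx, ext (star (s e)) (fun μ v ν => ?_) x hx⟩
      · have h : s e * matrixUnit μ v ν = matrixUnit (e :: μ) v ν := by
          simp only [matrixUnit, sPath, mul_assoc]
        rw [h]
        exact hM _ _ _
      · rcases star_s_mul_matrixUnit e μ v ν with h | ⟨μ', v', ν', h⟩ <;> rw [h]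
        exacts [zero_mem _, hM _ _ _]
    | zero n => intro x _; simp
    | add _ _ ha hb =>
      intro x hx
      rw [star_add, add_mul, add_mul]
      exact ⟨add_mem (ha x hx).1 (hb x hx).1, add_mem (ha x hx).2 (hb x hx).2⟩
    | smul c _ ha =>
      intro x hx
      rw [star_smul, smul_mul_assoc, smul_mul_assoc]
      exact ⟨M.smul_mem _ (ha x hx).1, M.smul_mem _ (ha x hx).2⟩
    | mul _ _ ha hb =>
      intro x hx
      rw [star_mul, mul_assoc, mul_assoc]
      exact ⟨(ha _ (hb x hx).1).1, (hb _ (ha x hx).2).2⟩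
    | star _ ha =>
      intro x hx
      rw [star_star]
      exact ⟨(ha x hx).2, (ha x hx).1⟩
  -- The unit `∑ p_v` lies in the span, hence so does `b = b * 1`.
  rw [← mul_unit b]
  refine (key _ ?_).1
  refine sum_mem fun v _ => ?_
  have h : p v = matrixUnit (E := E) [] v [] := by
    rw [matrixUnit, sPath, star_unit, unit_mul, mul_unit]
  rw [h]
  exact hM _ _ _

theorem IsGibbs.map_matrixUnit_eq_zero (hφ : IsGibbs q φ) (hq : 0 < q) (hq1 : q ≠ 1)
    {μ ν : List E.Edge} (h : μ.length ≠ ν.length) (v : E.V) : φ (matrixUnit μ v ν) = 0 := by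
  refine hφ.map_homogeneous_eq_zero hq hq1 (n := μ.length + 0 + -ν.length) (by omega) ?_
  exact ((isHomogeneous_sPath μ).mul (.p v)).mul (isHomogeneous_sPath ν).star

/-- A KMS state is determined by its values at the vertex projections. -/
theorem IsGibbs.ext (hφ : IsGibbs q φ) (hψ : IsGibbs q ψ) (hq : 0 < q) (hq1 : q ≠ 1)
    (h : ∀ v, φ (p v) = ψ (p v)) : φ = ψ := by
  have key : ∀ μ ν v, φ (matrixUnit μ v ν) = ψ (matrixUnit μ v ν) := by
    intro μ
    induction μ with
    | nil =>
      intro ν v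
      cases ν with
      | nil =>
        simp only [matrixUnit, sPath, star_unit, unit_mul, mul_unit, h]
      | cons f ν =>
        rw [hφ.map_matrixUnit_eq_zero hq hq1 (by simp), hψ.map_matrixUnit_eq_zero hq hq1 (by simp)]
    | cons e μ ih =>
      intro ν v
      cases ν with
      | nil =>
        rw [hφ.map_matrixUnit_eq_zero hq hq1 (by simp), hψ.map_matrixUnit_eq_zero hq hq1 (by simp)]
      | cons f ν =>
        have h0 : matrixUnit (e :: μ) v (f :: ν) = s e * (matrixUnit μ v ν * star (s f)) := by
          simp only [matrixUnit, sPath, mul_assoc, star_mul]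
        -- Moving `s_e` to the right end makes it meet `s_f^*`: the result is `0` for `e ≠ f`, and
        -- otherwise a vertex projection, which moves back to the left. One edge is thus stripped
        -- from both lists.
        rw [h0, hφ.map_s_mul, hψ.map_s_mul, mul_assoc]
        rcases eq_or_ne f e with rfl | hfe
        · rw [star_s_mul_s, ← hφ.map_p_mul, ← hψ.map_p_mul]
          rcases p_mul_matrixUnit (E.s f) μ v ν with h | h <;> rw [h]
          · rw [ih]
          · simp
        · rw [star_s_mul_s_of_ne hfe]
          simp
  refine eq_of_homogeneous fun n b hb => ?_
  have hle : Submodule.span ℂ {x | ∃ μ v ν, x = matrixUnit (E := E) μ v ν} ≤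
      LinearMap.eqLocus φ.toLinearMap ψ.toLinearMap :=
    Submodule.span_le.2 (by rintro _ ⟨μ, v, ν, rfl⟩; exact key μ ν v)
  exact hle (mem_span_matrixUnit hb)

/-! ## Convex combinations and pull-backs -/

theorem IsGibbs.convex (hφ : IsGibbs q φ) (hψ : IsGibbs q ψ) {a b : ℝ} (ha : 0 ≤ a) (hb : 0 ≤ b)
    (hab : a + b = 1) : IsGibbs q (a • φ + b • ψ) := by
  have happ : ∀ x, (a • φ + b • ψ) x = (a : ℂ) * φ x + b * ψ x := fun x => by
    simp
  refine ⟨fun x => ?_, ?_, fun v x => ?_, fun e x => ?_⟩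
  · rw [happ]
    exact add_nonneg (mul_nonneg (Complex.zero_le_real.2 ha) (hφ.nonneg x))
      (mul_nonneg (Complex.zero_le_real.2 hb) (hψ.nonneg x))
  · rw [happ, hφ.map_unit, hψ.map_unit, mul_one, mul_one, ← Complex.ofReal_add, hab,
      Complex.ofReal_one]
  · rw [happ, happ, hφ.map_p_mul, hψ.map_p_mul]
  · rw [happ, happ, hφ.map_s_mul, hψ.map_s_mul]
    ring

/-! ## Factorization -/

theorem FactorsThrough.of_isState {B : Type} [NonUnitalCStarAlgebra B] {ψ : StrongDual ℂ B}
    (hψ : IsState ψ) (π : Toeplitz E →⋆ₙₐ[ℂ] B) : FactorsThrough (ψ.comp (homL π)) π :=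
  ⟨ψ, hψ, fun _ => rfl⟩

/-- The quotient map preserves the unit and sends each generator to a generator of the same kind or
to `0`, so all the relations transfer. -/
theorem IsGibbs.pullback {H : Set E.V} (hH : E.IsHereditary H)
    {ψ : StrongDual ℂ (Toeplitz (E.delete H hH))} (hψ : IsGibbs q ψ) :
    IsGibbs q (ψ.comp (homL (toDelete E H hH))) := by
  have hp : ∀ v, toDelete E H hH (p v) = deleteP H hH v := lift_p _
  have hs : ∀ e, toDelete E H hH (s e) = deleteS H hH e := lift_s _
  refine ⟨fun a => ?_, ?_, fun v a => ?_, fun e a => ?_⟩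
  · simp only [ContinuousLinearMap.comp_apply, homL_apply, map_mul, map_star]
    exact hψ.nonneg _
  · simp only [ContinuousLinearMap.comp_apply, homL_apply]
    rw [← hψ.map_unit, unit, map_sum, unit]
    congr 1
    symm
    refine Finset.sum_of_injOn (fun v : (E.delete H hH).V => v.1)
      Subtype.val_injective.injOn (fun _ _ => Finset.mem_univ _) ?_ ?_
    · intro v _ hv
      rw [hp, deleteP_of_mem]
      by_contra hvH
      exact hv ⟨⟨v, hvH⟩, Finset.mem_univ _, rfl⟩
    · intro v _
      rw [hp, deleteP_of_notMem hH v.2]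
      rfl
  · simp only [ContinuousLinearMap.comp_apply, homL_apply, map_mul, hp]
    by_cases h : v ∈ H
    · simp [deleteP_of_mem hH h]
    · rw [deleteP_of_notMem hH h]
      exact hψ.map_p_mul _ _
  · simp only [ContinuousLinearMap.comp_apply, homL_apply, map_mul, hs]
    by_cases h : E.s e ∈ H
    · simp [deleteS_of_mem hH h]
    · rw [deleteS_of_notMem hH h]
      exact hψ.map_s_mul _ _

/-- A state that vanishes on a closed ideal induces a state of the quotient. -/
theorem factorsThrough_mk {A : Type*} [NonUnitalCStarAlgebra A] {φ : StrongDual ℂ A}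
    (hφ : IsState φ) (J : ClosedIdeal A) (hJ : ∀ x ∈ J.toSubmodule, φ x = 0) :
    FactorsThrough φ (CStarQuotient.mk J) := by
  let ψ₀ : CStarQuotient J →ₗ[ℂ] ℂ :=
    (J.toSubmodule.liftQ φ.toLinearMap (fun x hx => hJ x hx) : A ⧸ J.toSubmodule →ₗ[ℂ] ℂ)
  have hψ₀ : ∀ a, ψ₀ (CStarQuotient.mk J a) = φ a := fun a => rfl
  have hbound : ∀ x, ‖ψ₀ x‖ ≤ 1 * ‖x‖ := by
    intro x
    rw [one_mul]
    refine le_of_forall_pos_le_add fun ε hε => ?_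
    obtain ⟨a, rfl, ha⟩ := QuotientAux.exists_norm_lt (J := J) x hε
    refine le_trans ?_ ha.le
    change ‖φ a‖ ≤ ‖a‖
    simpa [hφ.2] using φ.le_opNorm a
  let ψ : StrongDual ℂ (CStarQuotient J) := ψ₀.mkContinuous 1 hbound
  refine ⟨ψ, ⟨fun x => ?_, le_antisymm (ψ₀.mkContinuous_norm_le zero_le_one hbound) ?_⟩,
    fun a => rfl⟩
  · obtain ⟨a, rfl⟩ := CStarQuotient.mk_surjective J x
    rw [← map_star, ← map_mul]
    exact hφ.1 a
  -- The quotient map is a contraction, so the induced functional has norm at least that of `φ`.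
  · rw [← hφ.2]
    refine φ.opNorm_le_bound (norm_nonneg _) fun a => ?_
    calc ‖φ a‖ = ‖ψ (CStarQuotient.mk J a)‖ := rfl
      _ ≤ ‖ψ‖ * ‖CStarQuotient.mk J a‖ := ψ.le_opNorm _
      _ ≤ ‖ψ‖ * ‖a‖ := by gcongr; exact QuotientAux.norm_mk_le (J := J) a

/-- A KMS state factors through `C*(E)` if and only if it vanishes at the gap projections. -/
theorem IsGibbs.factorsThrough_iff (hφ : IsGibbs q φ) (hq : q ≠ 0) :
    FactorsThrough φ (toCuntzKrieger E) ↔ ∀ v, φ ((univ E).gap v) = 0 := by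
  constructor
  · rintro ⟨ψ, -, hψ⟩ v
    rw [hψ]
    have : toCuntzKrieger E ((univ E).gap v) = 0 :=
      (CStarQuotient.mk_eq_zero_iff _ _).2 <| Submodule.mem_sInf.2 fun I hI => hI.2.2 ⟨v, rfl⟩
    rw [this, map_zero]
  · intro h
    -- The gap is a projection, so `φ(gap^* gap) = 0` and Cauchy-Schwarz applies.
    have hgap : ∀ v b, φ ((univ E).gap v * b) = 0 := fun v b => by
      have := apply_eq_zero_of_left hφ.nonneg (x := (univ E).gap v)
        (by rw [star_gap, gap_mul_self, h]) b
      rwa [star_gap] at this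
    -- A homogeneous left factor is carried to the right end by the KMS relation, at the cost of a
    -- power of `q`; density covers general `a`.
    have hgap2 : ∀ v a b, φ (a * (univ E).gap v * b) = 0 := fun v a b => by
      have : φ.comp ((ContinuousLinearMap.mul ℂ (Toeplitz E)).flip ((univ E).gap v * b)) = 0 := by
        refine eq_of_homogeneous fun n c hc => ?_
        change φ (c * ((univ E).gap v * b)) = 0
        rw [hφ.map_homogeneous_mul hq hc, mul_assoc, hgap, mul_zero]
      rw [mul_assoc]
      exact congrArg (fun g : StrongDual ℂ (Toeplitz E) => g a) this
    refine factorsThrough_mk hφ.isState _ fun x hx => ?_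
    -- The largest two-sided ideal on which `φ` vanishes. It is closed and contains the gaps, hence
    -- the whole gap ideal.
    let I : Submodule ℂ (Toeplitz E) :=
      { carrier := {x | ∀ a b, φ (a * x * b) = 0}
        add_mem' := fun {x y} hx hy a b => by rw [mul_add, add_mul, map_add, hx, hy, add_zero]
        zero_mem' := by simp
        smul_mem' := fun c x hx a b => by
          rw [mul_smul_comm, smul_mul_assoc, map_smul, hx, smul_zero] }
    have hI : x ∈ I := by
      refine Submodule.mem_sInf.1 hx I ⟨?_, fun a y hy => ⟨fun b c => ?_, fun b c => ?_⟩, ?_⟩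
      · have : (I : Set (Toeplitz E)) = ⋂ a, ⋂ b, {x | φ (a * x * b) = 0} := by
          ext x
          simp only [Set.mem_iInter]
          rfl
        rw [this]
        exact isClosed_iInter fun a => isClosed_iInter fun b =>
          isClosed_eq (by fun_prop) continuous_const
      · rw [← mul_assoc b]; exact hy _ _
      · rw [← mul_assoc b, mul_assoc]; exact hy _ _
      · rintro _ ⟨v, rfl⟩ a b
        exact hgap2 v a b
    have := hI (unit E) (unit E)
    rwa [mul_unit, unit_mul] at this

/-! ## Limits -/

/-- Banach-Alaoglu along an ultrafilter: states lie in the weak-* compact unit ball, and each Gibbs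
relation is a closed condition that is jointly continuous in `q` and `φ`. Normalisation survives
because it is the value at the unit. The last clause carries over values common to the whole
sequence, such as vanishing at a gap projection. -/
theorem exists_isGibbs_limit {φ : ℕ → StrongDual ℂ (Toeplitz E)} {q : ℕ → ℝ} {q₀ : ℝ}
    (hφ : ∀ n, IsGibbs (q n) (φ n)) (hq : Filter.Tendsto q Filter.atTop (nhds q₀)) :
    ∃ φ₀ : StrongDual ℂ (Toeplitz E), IsGibbs q₀ φ₀ ∧
      ∀ a c, (∀ n, φ n a = c) → φ₀ a = c := by
  let F : Ultrafilter ℕ := Filter.hyperfilter ℕ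
  have hF : (F : Filter ℕ) ≤ Filter.atTop := Nat.hyperfilter_le_atTop
  let φ' : ℕ → WeakDual ℂ (Toeplitz E) := fun n => StrongDual.toWeakDual (φ n)
  obtain ⟨φ₀, -, hlim⟩ := isCompact_iff_ultrafilter_le_nhds.1
    (WeakDual.isCompact_closedBall (𝕜 := ℂ) (E := Toeplitz E) 0 1) (F.map φ') (by
      rw [Filter.le_principal_iff]
      refine Filter.mem_map.2 (Filter.Eventually.of_forall fun n => ?_)
      change φ n ∈ Metric.closedBall 0 1
      rw [mem_closedBall_zero_iff, (hφ n).isState.2])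
  have hlim' : ∀ a, Filter.Tendsto (fun n => φ n a) F (nhds (φ₀ a)) := fun a =>
    ((WeakDual.eval_continuous a).tendsto φ₀).comp hlim
  have hconst : ∀ a c, (∀ n, φ n a = c) → φ₀ a = c := fun a c h =>
    tendsto_nhds_unique (hlim' a) (by simp only [h]; exact tendsto_const_nhds)
  have hqF : Filter.Tendsto (fun n => (q n : ℂ)) F (nhds (q₀ : ℂ)) :=
    (Complex.continuous_ofReal.tendsto q₀).comp (hq.mono_left hF)
  refine ⟨WeakDual.toStrongDual φ₀, ⟨fun a => ?_, ?_, fun v a => ?_, fun e a => ?_⟩, hconst⟩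
  · exact ge_of_tendsto' (hlim' (star a * a)) fun n => (hφ n).nonneg a
  · exact hconst _ _ fun n => (hφ n).map_unit
  · refine tendsto_nhds_unique (hlim' (p v * a)) ?_
    simp only [(hφ _).map_p_mul]
    exact hlim' _
  · refine tendsto_nhds_unique (hlim' (s e * a)) ?_
    simp only [(hφ _).map_s_mul]
    exact hqF.mul (hlim' _)

end Gibbs

/-! ## Operators on `ℓ²` defined by partial bijections -/

section PartialBijection

variable {X Y Z : Type*}

/-- Reindexing a sum along a partial bijection. -/
theorem _root_.PEquiv.hasSum_elim_iff {M : Type*} [AddCommMonoid M] [TopologicalSpace M]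
    (σ : X ≃. Y) (F : X → Y → M) (a : M) :
    HasSum (fun x => (σ x).elim 0 (F x)) a ↔ HasSum (fun y => (σ.symm y).elim 0 (F · y)) a := by
  have hget : ∀ y : Function.support fun y => (σ.symm y).elim 0 (F · y),
      ∃ x, σ.symm y = some x := fun y => by
    rcases h : σ.symm y with _ | x
    · exact absurd (by simp [h]) y.2
    · exact ⟨x, rfl⟩
  choose i hi using hget
  refine hasSum_iff_hasSum_of_ne_zero_bij i ?_ ?_ fun y => ?_
  · intro y y' h
    have h1 := σ.eq_some_iff.1 (hi y)
    have h2 := σ.eq_some_iff.1 (hi y')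
    rw [h, h2] at h1
    exact Subtype.ext (Option.some.inj h1).symm
  · intro x hx
    rcases h : σ x with _ | y
    · exact absurd (by simp [h]) hx
    · have h' := σ.eq_some_iff.2 h
      refine ⟨⟨y, ?_⟩, ?_⟩
      · simpa [h', h] using hx
      · have := hi ⟨y, by simpa [h', h] using hx⟩
        exact (Option.some.inj (h'.symm.trans this)).symm
  · rw [hi, σ.eq_some_iff.1 (hi y)]
    rfl

theorem _root_.PEquiv.tsum_elim {M : Type*} [AddCommMonoid M] [TopologicalSpace M] [T2Space M]
    (σ : X ≃. Y) (F : X → Y → M) :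
    ∑' x, (σ x).elim 0 (F x) = ∑' y, (σ.symm y).elim 0 (F · y) := by
  exact tsum_eq_tsum_of_hasSum_iff_hasSum fun {a} => σ.hasSum_elim_iff F a

/-- The Hilbert space `ℓ²(X)`. -/
abbrev EllTwo (X : Type*) : Type _ := lp (fun _ : X => ℂ) 2

theorem EllTwo.summable_sq (ξ : EllTwo X) : Summable fun x => ‖ξ x‖ ^ 2 := by
  simpa using (lp.hasSum_norm (p := 2) (by norm_num) ξ).summable

theorem EllTwo.norm_sq (ξ : EllTwo X) : ‖ξ‖ ^ 2 = ∑' x, ‖ξ x‖ ^ 2 := by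
  simpa using lp.norm_rpow_eq_tsum (p := 2) (by norm_num) ξ

/-- The sum over the domain of `σ` is the sum of `f` over its range, a subset of `Y`. This makes
`shift` a contraction. -/
theorem summable_elim (σ : X ≃. Y) {f : Y → ℝ} (hf : Summable f) (h0 : ∀ y, 0 ≤ f y) :
    Summable (fun x => (σ x).elim 0 f) ∧ ∑' x, (σ x).elim 0 f ≤ ∑' y, f y := by
  have hle : ∀ y, (σ.symm y).elim 0 (fun _ => f y) ≤ f y := fun y => by
    rcases σ.symm y with _ | x
    exacts [h0 y, le_rfl]
  have h1 : Summable fun y => (σ.symm y).elim 0 (fun _ => f y) := by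
    refine hf.of_nonneg_of_le (fun y => ?_) hle
    rcases σ.symm y with _ | x
    exacts [le_rfl, h0 y]
  have h2 := (σ.hasSum_elim_iff (fun _ y => f y) _).2 h1.hasSum
  exact ⟨h2.summable, by rw [h2.tsum_eq]; exact h1.tsum_le_tsum hle hf⟩

/-- The partial isometry of `ℓ²` defined by a partial bijection. -/
def shift (σ : X ≃. Y) : EllTwo Y →L[ℂ] EllTwo X :=
  LinearMap.mkContinuous
    { toFun := fun ξ => ⟨fun x => (σ x).elim 0 ξ, memℓp_gen (by
        have h := (summable_elim σ ξ.summable_sq fun _ => by positivity).1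
        refine h.congr fun x => ?_
        rcases σ x with _ | y <;> simp)⟩
      map_add' := fun ξ η => by
        ext x
        change (σ x).elim (0 : ℂ) (fun y => ξ y + η y) = (σ x).elim 0 ξ + (σ x).elim 0 η
        rcases σ x with _ | y
        exacts [(add_zero _).symm, rfl]
      map_smul' := fun c ξ => by
        ext x
        change (σ x).elim (0 : ℂ) (fun y => c • ξ y) = c • (σ x).elim 0 ξ
        rcases σ x with _ | y
        exacts [(smul_zero _).symm, rfl] } 1 fun ξ => by
    rw [one_mul]
    refine abs_le_of_sq_le_sq' ?_ (norm_nonneg _) |>.2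
    rw [EllTwo.norm_sq, EllTwo.norm_sq]
    refine le_of_eq_of_le ?_ (summable_elim σ ξ.summable_sq fun _ => by positivity).2
    refine tsum_congr fun x => ?_
    change ‖(σ x).elim 0 ξ‖ ^ 2 = _
    rcases σ x with _ | y <;> simp

theorem shift_apply (σ : X ≃. Y) (ξ : EllTwo Y) (x : X) : shift σ ξ x = (σ x).elim 0 ξ := rfl

theorem shift_mul (σ τ : X ≃. X) : shift σ * shift τ = shift (σ.trans τ) := by
  ext ξ x
  change (σ x).elim 0 (fun y => (τ y).elim 0 ξ) = ((σ x).bind τ).elim 0 ξ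
  rcases σ x with _ | y <;> rfl

/-- Both inner products are the same sum over the graph of `σ`, indexed by either coordinate. -/
theorem star_shift (σ : X ≃. X) : star (shift σ) = shift σ.symm := by
  rw [ContinuousLinearMap.star_eq_adjoint]
  symm
  rw [ContinuousLinearMap.eq_adjoint_iff]
  intro ξ η
  rw [lp.inner_eq_tsum, lp.inner_eq_tsum]
  have h := σ.symm.tsum_elim fun x y => inner ℂ (ξ y) (η x)
  rw [σ.symm_symm] at h
  refine Eq.trans (tsum_congr fun x => ?_) (h.trans (tsum_congr fun y => ?_))
  · rw [shift_apply]
    rcases σ.symm x with _ | y <;> simp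
  · rw [shift_apply]
    rcases σ y with _ | x <;> simp

open scoped Classical in
/-- The standard basis vectors of `ℓ²`. -/
def delta (x : X) : EllTwo X := lp.single 2 x 1

open scoped Classical in
theorem delta_apply (x y : X) : delta x y = if y = x then 1 else 0 := by
  rw [delta, lp.single_apply, Pi.single_apply]

theorem norm_delta (x : X) : ‖delta x‖ = 1 := by
  classical
  rw [delta, lp.norm_single (by norm_num), norm_one]

theorem inner_delta (x : X) (ξ : EllTwo X) : inner ℂ (delta x) ξ = ξ x := by
  classical
  rw [delta, lp.inner_single_left]
  simp

/-- `shift` composes a vector with `σ`, so it moves basis vectors by the inverse partial map. -/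
theorem shift_delta (σ : X ≃. Y) (y : Y) : shift σ (delta y) = (σ.symm y).elim 0 delta := by
  classical
  ext x
  rw [shift_apply]
  rcases h : σ.symm y with _ | x'
  · rcases h' : σ x with _ | y'
    · rfl
    · change delta y y' = 0
      rw [delta_apply, if_neg]
      rintro rfl
      rw [← σ.eq_some_iff, h] at h'
      cases h'
  · change _ = delta x' x
    rw [delta_apply]
    rcases h' : σ x with _ | y'
    · rw [if_neg]
      · rfl
      · rintro rfl
        rw [σ.eq_some_iff, h'] at h
        cases h
    · change delta y y' = _
      rw [delta_apply]
      refine if_congr ⟨?_, ?_⟩ rfl rfl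
      · rintro rfl
        rw [← σ.eq_some_iff, h] at h'
        exact (Option.some.inj h').symm
      · rintro rfl
        rw [σ.eq_some_iff, h'] at h
        exact Option.some.inj h

/-! ## Gibbs functionals on the bounded operators of `ℓ²` -/

/-- The functional `T ↦ ⟨δ_x, T δ_x⟩`. -/
def diagCoeff (x : X) : StrongDual ℂ (EllTwo X →L[ℂ] EllTwo X) :=
  (innerSL ℂ (delta x)).comp (ContinuousLinearMap.apply ℂ (EllTwo X) (delta x))

theorem diagCoeff_apply (x : X) (T : EllTwo X →L[ℂ] EllTwo X) :
    diagCoeff x T = T (delta x) x := inner_delta x _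

theorem norm_diagCoeff_le (x : X) : ‖diagCoeff (X := X) x‖ ≤ 1 := by
  refine ContinuousLinearMap.opNorm_le_bound _ zero_le_one fun T => ?_
  change ‖inner ℂ (delta x) (T (delta x))‖ ≤ _
  refine (norm_inner_le_norm _ _).trans ?_
  rw [norm_delta]
  gcongr
  simpa [norm_delta] using T.le_opNorm (delta x)

/-- The series of functionals converges absolutely in norm, so it may be evaluated termwise. -/
theorem hasSum_weighted_apply {A : Type*} [NormedAddCommGroup A] [NormedSpace ℂ A]
    {f : X → StrongDual ℂ A} (hf : ∀ x, ‖f x‖ ≤ 1) {ω : X → ℝ} (hω : Summable ω)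
    (h0 : ∀ x, 0 ≤ ω x) (a : A) :
    HasSum (fun x => (ω x : ℂ) * f x a) ((∑' x, (ω x : ℂ) • f x) a) := by
  have h : Summable fun x => (ω x : ℂ) • f x := by
    refine Summable.of_norm_bounded hω fun x => ?_
    rw [norm_smul, Complex.norm_real, Real.norm_of_nonneg (h0 x)]
    exact mul_le_of_le_one_right (h0 x) (hf x)
  exact h.hasSum.mapL (ContinuousLinearMap.apply ℂ ℂ a)

/-- The weighted trace `T ↦ ∑ ω(x) ⟨δ_x, T δ_x⟩`. -/
def gibbsTrace (ω : X → ℝ) : StrongDual ℂ (EllTwo X →L[ℂ] EllTwo X) :=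
  ∑' x, (ω x : ℂ) • diagCoeff x

theorem hasSum_gibbsTrace {ω : X → ℝ} (hω : Summable ω) (h0 : ∀ x, 0 ≤ ω x)
    (T : EllTwo X →L[ℂ] EllTwo X) :
    HasSum (fun x => (ω x : ℂ) * T (delta x) x) (gibbsTrace ω T) := by
  have h := hasSum_weighted_apply (norm_diagCoeff_le (X := X)) hω h0 T
  simp only [diagCoeff_apply] at h
  exact h

theorem gibbsTrace_nonneg {ω : X → ℝ} (hω : Summable ω) (h0 : ∀ x, 0 ≤ ω x)
    (T : EllTwo X →L[ℂ] EllTwo X) : 0 ≤ gibbsTrace ω (star T * T) := by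
  refine (hasSum_gibbsTrace hω h0 _).nonneg fun x => ?_
  -- The diagonal coefficient of `T^* T` at `δ_x` is `‖T δ_x‖²`.
  refine mul_nonneg (Complex.zero_le_real.2 (h0 x)) ?_
  rw [← inner_delta, mul_apply_eq_comp, ContinuousLinearMap.star_eq_adjoint,
    ContinuousLinearMap.adjoint_inner_right, inner_self_eq_norm_sq_to_K]
  positivity

/-- If `ω` scales by `q` along `σ`, then the weighted trace satisfies the KMS condition. -/
theorem gibbsTrace_shift_mul {ω : X → ℝ} (hω : Summable ω) (h0 : ∀ x, 0 ≤ ω x) {σ : X ≃. X}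
    {q : ℝ} (hσ : ∀ x y, σ x = some y → ω x = q * ω y) (T : EllTwo X →L[ℂ] EllTwo X) :
    gibbsTrace ω (shift σ * T) = q * gibbsTrace ω (T * shift σ) := by
  have h1 := hasSum_gibbsTrace hω h0 (shift σ * T)
  have h2 := (hasSum_gibbsTrace hω h0 (T * shift σ)).mul_left (q : ℂ)
  refine h1.unique ?_
  -- Both traces are sums of `(T δ_x)(y)` over the pairs `σ x = y`, one with weight `ω x` and the
  -- other with `q ω y`.
  have h3 := (σ.symm.hasSum_elim_iff (fun y x => (ω x : ℂ) * T (delta x) y)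
    (q * gibbsTrace ω (T * shift σ))).1 (by
      refine h2.congr_fun fun y => ?_
      rw [mul_apply_eq_comp, shift_delta]
      rcases h : σ.symm y with _ | x
      · simp
      · rw [Option.elim_some, Option.elim_some, hσ x y (σ.eq_some_iff.1 h)]
        push_cast
        ring)
  rw [σ.symm_symm] at h3
  refine h3.congr_fun fun x => ?_
  rw [mul_apply_eq_comp, shift_apply]
  rcases σ x with _ | y <;> simp

end PartialBijection

/-! ## The path space representation -/

section PathSpace

open Toeplitz

variable {E : FinGraph} (x : E.V)

open scoped Classical in
/-- The range of a path with source `x`, written as the list of its edges; `none` if the list is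
not a path with source `x`. -/
def pathRange : List E.Edge → Option E.V
  | [] => some x
  | e :: l => if pathRange l = some (E.s e) then some (E.r e) else none

open scoped Classical in
/-- The partial bijection that removes the edge `e` from a path `e l`. -/
def edgeShift (e : E.Edge) : List E.Edge ≃. List E.Edge where
  toFun
    | [] => none
    | f :: l => if f = e ∧ pathRange x l = some (E.s e) then some l else none
  invFun l := if pathRange x l = some (E.s e) then some (e :: l) else none
  inv a b := by
    rcases a with _ | ⟨f, l⟩
    · simp
    · simp only [Option.ite_none_right_eq_some, Option.some.injEq,
        List.cons.injEq]
      constructor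
      · rintro ⟨h, rfl, rfl⟩; exact ⟨⟨rfl, h⟩, rfl⟩
      · rintro ⟨⟨rfl, h⟩, rfl⟩; exact ⟨h, rfl, rfl⟩

theorem edgeShift_nil (e : E.Edge) : edgeShift x e [] = none := rfl

open scoped Classical in
theorem edgeShift_cons (e f : E.Edge) (l : List E.Edge) : edgeShift x e (f :: l) =
    if f = e ∧ pathRange x l = some (E.s e) then some l else none := rfl

open scoped Classical in
theorem edgeShift_symm (e : E.Edge) (l : List E.Edge) : (edgeShift x e).symm l =
    if pathRange x l = some (E.s e) then some (e :: l) else none := rfl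

open scoped Classical in
/-- The projection onto `ℓ²(S)`. -/
def indicatorProj {X : Type*} (S : Set X) : EllTwo X →L[ℂ] EllTwo X := shift (PEquiv.ofSet S)

open scoped Classical in
theorem indicatorProj_apply {X : Type*} (S : Set X) (ξ : EllTwo X) (l : X) :
    indicatorProj S ξ l = if l ∈ S then ξ l else 0 := by
  change (if l ∈ S then some l else none : Option X).elim 0 ξ = _
  split_ifs <;> rfl

theorem star_indicatorProj {X : Type*} (S : Set X) :
    star (indicatorProj S) = indicatorProj S := by
  classical
  rw [indicatorProj, star_shift, PEquiv.ofSet_symm]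

theorem indicatorProj_mul {X : Type*} (S T : Set X) :
    indicatorProj S * indicatorProj T = indicatorProj (S ∩ T) := by
  classical
  ext ξ l
  rw [mul_apply_eq_comp, indicatorProj_apply, indicatorProj_apply,
    indicatorProj_apply]
  by_cases h : l ∈ S <;> by_cases h' : l ∈ T <;> simp [h, h']

theorem shift_mul_star {X : Type*} (σ : X ≃. X) :
    shift σ * star (shift σ) = indicatorProj {a | (σ a).isSome} := by
  classical
  rw [star_shift, shift_mul, PEquiv.self_trans_symm, indicatorProj]
  congr!

theorem star_shift_mul {X : Type*} (σ : X ≃. X) :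
    star (shift σ) * shift σ = indicatorProj {a | (σ.symm a).isSome} := by
  have h := shift_mul_star σ.symm
  rwa [star_shift, σ.symm_symm, ← star_shift] at h

-- A nonempty path with range `v` lies in the range of exactly one of the operators, that of its
-- first edge. Only the empty path is left over, and its range is `x`.
open scoped Classical in
theorem path_gap (v : E.V) :
    indicatorProj {l | pathRange x l = some v} -
      ∑ e with E.r e = v, shift (edgeShift x e) * star (shift (edgeShift x e)) =
    indicatorProj {l | l = [] ∧ x = v} := by
  simp only [shift_mul_star]
  ext ξ l
  change indicatorProj _ ξ l - (∑ e with E.r e = v, indicatorProj _) ξ l = _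
  rw [_root_.sum_apply, lp.coeFn_sum, Finset.sum_apply]
  simp only [indicatorProj_apply, Set.mem_ofPred_eq]
  rcases l with _ | ⟨f, l⟩
  · simp [edgeShift_nil, pathRange]
  · rw [if_neg (show ¬ (f :: l = [] ∧ x = v) by simp), sub_eq_zero, Finset.sum_filter]
    rw [Finset.sum_eq_single f]
    · simp only [edgeShift_cons, pathRange, true_and]
      by_cases h : pathRange x l = some (E.s f) <;> by_cases h' : E.r f = v <;> simp [h, h']
    · intro e _ he
      simp [edgeShift_cons, Ne.symm he]
    · simp

/-- The Toeplitz-Cuntz-Krieger family on the `ℓ²`-space of the paths with source `x`. -/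
def pathFamily : TCKFamily E (EllTwo (List E.Edge) →L[ℂ] EllTwo (List E.Edge)) where
  P v := indicatorProj {l | pathRange x l = some v}
  S e := shift (edgeShift x e)
  isStarProjection v :=
    ⟨by rw [IsIdempotentElem, indicatorProj_mul, Set.inter_self], star_indicatorProj _⟩
  orthogonal v w h := by
    classical
    rw [indicatorProj_mul]
    ext ξ l
    rw [indicatorProj_apply, if_neg]
    · rfl
    · rintro ⟨h1, h2⟩
      exact h (Option.some.inj (h1.symm.trans h2))
  star_mul_self e := by
    rw [star_shift_mul]
    congr 1
    ext l
    simp [edgeShift_symm]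
  sum_le v := by
    refine ⟨indicatorProj {l | l = [] ∧ x = v}, ?_⟩
    rw [star_indicatorProj, indicatorProj_mul, Set.inter_self, ← path_gap]

/-! ## Summability of the Gibbs weights -/

variable (q : ℝ)

open scoped Classical in
/-- The weight `q^|l|` of a path `l` with source `x` and range `y`. -/
def pathWeightTo (y : E.V) (l : List E.Edge) : ℝ :=
  if pathRange x l = some y then q ^ l.length else 0

/-- The weight `q^|l|` of a path `l` with source `x`. -/
def pathWeight (l : List E.Edge) : ℝ := if (pathRange x l).isSome then q ^ l.length else 0

theorem pathWeight_eq_sum (l : List E.Edge) :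
    pathWeight x q l = ∑ y, pathWeightTo x q y l := by
  classical
  simp only [pathWeight, pathWeightTo]
  rcases pathRange x l with _ | y <;> simp

open scoped Classical in
theorem pathWeightTo_cons (y : E.V) (e : E.Edge) (l : List E.Edge) :
    pathWeightTo x q y (e :: l) =
      if E.r e = y then q * pathWeightTo x q (E.s e) l else 0 := by
  simp only [pathWeightTo, pathRange, List.length_cons, pow_succ']
  by_cases h : pathRange x l = some (E.s e) <;> by_cases h' : E.r e = y <;> simp [h, h']

variable {q}

theorem pathWeight_nonneg (hq : 0 ≤ q) (l : List E.Edge) : 0 ≤ pathWeight x q l := by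
  unfold pathWeight
  split_ifs
  exacts [pow_nonneg hq _, le_rfl]

open scoped Classical in
/-- The lists of length `< n`. -/
def shortLists (α : Type*) [Fintype α] : ℕ → Finset (List α)
  | 0 => ∅
  | n + 1 => insert [] ((Finset.univ ×ˢ shortLists α n).map
      ⟨fun p : α × List α => p.1 :: p.2, fun p p' h => by
        simp only [List.cons.injEq] at h; exact Prod.ext h.1 h.2⟩)

theorem mem_shortLists {α : Type*} [Fintype α] {n : ℕ} {l : List α} (h : l.length < n) :
    l ∈ shortLists α n := by
  induction n generalizing l with
  | zero => omega
  | succ n ih =>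
    rcases l with _ | ⟨a, l⟩
    · simp [shortLists]
    · simp only [shortLists, Finset.mem_insert, Finset.mem_map, Finset.mem_product,
        Finset.mem_univ, true_and]
      exact .inr ⟨(a, l), ih (by simpa using h), rfl⟩

-- A path is empty or of the form `e l`, so the truncated weight sums are the iterates of `g ↦ δ_x +
-- q A g` started at `0`. Any nonnegative `h` with `δ_x + q A h ≤ h` bounds them all.
open scoped Classical in
theorem sum_shortLists_le (hq : 0 ≤ q) {h : E.V → ℝ} (h0 : ∀ y, 0 ≤ h y)
    (hh : ∀ y, (if x = y then 1 else 0) + q * ∑ e with E.r e = y, h (E.s e) ≤ h y) (n : ℕ)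
    (y : E.V) : ∑ l ∈ shortLists E.Edge n, pathWeightTo x q y l ≤ h y := by
  induction n generalizing y with
  | zero => simpa [shortLists] using h0 y
  | succ n ih =>
    rw [shortLists, Finset.sum_insert (by simp), Finset.sum_map, Finset.sum_product]
    refine le_trans ?_ (hh y)
    have hnil : pathWeightTo x q y [] = if x = y then 1 else 0 := by
      simp [pathWeightTo, pathRange]
    rw [hnil]
    gcongr
    rw [Finset.mul_sum, Finset.sum_filter]
    refine Finset.sum_le_sum fun e _ => ?_
    change ∑ l ∈ shortLists E.Edge n, pathWeightTo x q y (e :: l) ≤ _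
    simp only [pathWeightTo_cons]
    split_ifs
    · rw [← Finset.mul_sum]
      exact mul_le_mul_of_nonneg_left (ih _) hq
    · simp

open scoped Classical in
/-- The weights are summable if there is a superharmonic function. -/
theorem summable_pathWeight (hq : 0 ≤ q) {h : E.V → ℝ} (h0 : ∀ y, 0 ≤ h y)
    (hh : ∀ y, (if x = y then 1 else 0) + q * ∑ e with E.r e = y, h (E.s e) ≤ h y) :
    Summable (pathWeight x q) := by
  refine summable_of_sum_le (c := ∑ y, h y) (pathWeight_nonneg x hq) fun u => ?_
  obtain ⟨n, hn⟩ : ∃ n, u ⊆ shortLists E.Edge n :=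
    ⟨u.sup List.length + 1, fun l hl => mem_shortLists (Nat.lt_succ_of_le (Finset.le_sup hl))⟩
  refine (Finset.sum_le_sum_of_subset_of_nonneg hn fun l _ _ => pathWeight_nonneg x hq l).trans ?_
  simp only [pathWeight_eq_sum]
  rw [Finset.sum_comm]
  exact Finset.sum_le_sum fun y _ => sum_shortLists_le x hq h0 hh n y

/-! ## Existence of KMS states -/

/-- The normalised trace with the weights `q^|l|` in the path space representation is a KMS
functional. -/
theorem exists_isGibbs (hq : 0 ≤ q) (hs : Summable (pathWeight x q)) :
    ∃ φ : StrongDual ℂ (Toeplitz E), IsGibbs q φ ∧ ∀ y, y ≠ x → φ ((univ E).gap y) = 0 := by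
  classical
  set Z := ∑' l, pathWeight x q l with hZ
  have hZ0 : 0 < Z := by
    -- The empty path has weight `1`.
    refine hs.tsum_pos (pathWeight_nonneg x hq) [] ?_
    simp [pathWeight, pathRange]
  set ω : List E.Edge → ℝ := fun l => Z⁻¹ * pathWeight x q l with hω
  have hωs : Summable ω := hs.mul_left _
  have hω0 : ∀ l, 0 ≤ ω l := fun l => mul_nonneg (inv_nonneg.2 hZ0.le) (pathWeight_nonneg x hq l)
  have hω1 : HasSum ω 1 := by
    have := hs.hasSum.mul_left Z⁻¹
    rwa [← hZ, inv_mul_cancel₀ hZ0.ne'] at this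
  have hedge : ∀ e l l', edgeShift x e l = some l' → ω l = q * ω l' := by
    intro e l l' h
    rcases l with _ | ⟨f, l⟩
    · cases h
    · rw [edgeShift_cons, Option.ite_none_right_eq_some, Option.some.injEq] at h
      obtain ⟨⟨rfl, h⟩, rfl⟩ := h
      simp only [hω, pathWeight, pathRange, h, if_true, Option.isSome_some, List.length_cons,
        pow_succ']
      ring
  have hp : ∀ v, lift (pathFamily x) (p v) = indicatorProj {l | pathRange x l = some v} :=
    lift_p _
  have hsE : ∀ e, lift (pathFamily x) (s e) = shift (edgeShift x e) := lift_s _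
  refine ⟨(gibbsTrace ω).comp (homL (lift (pathFamily x))), ⟨fun a => ?_, ?_, fun v a => ?_,
    fun e a => ?_⟩, fun y hy => ?_⟩
  · rw [ContinuousLinearMap.comp_apply, homL_apply, map_mul, map_star]
    exact gibbsTrace_nonneg hωs hω0 _
  · rw [ContinuousLinearMap.comp_apply, homL_apply, unit, map_sum]
    refine (hasSum_gibbsTrace hωs hω0 _).unique ?_
    have h1 := Complex.hasSum_ofReal.2 hω1
    rw [Complex.ofReal_one] at h1
    -- The unit acts as the projection onto genuine paths, and `ω` vanishes on all other lists.
    refine h1.congr_fun fun l => ?_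
    simp only [hp]
    rw [_root_.sum_apply, lp.coeFn_sum, Finset.sum_apply]
    simp only [indicatorProj_apply, delta_apply, Set.mem_ofPred_eq, if_true, hω, pathWeight]
    rcases pathRange x l with _ | v <;> simp
  · simp only [ContinuousLinearMap.comp_apply, homL_apply, map_mul, hp]
    -- A vertex projection is the shift of a partial identity, along which the weight does not
    -- change; hence the scaling factor `1`.
    rw [indicatorProj, gibbsTrace_shift_mul hωs hω0 (q := 1), Complex.ofReal_one, one_mul]
    intro l l' h
    rw [PEquiv.ofSet_eq_some_iff] at h
    rw [one_mul, h.1]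
  · simp only [ContinuousLinearMap.comp_apply, homL_apply, map_mul, hsE]
    exact gibbsTrace_shift_mul hωs hω0 (hedge e) _
  · rw [ContinuousLinearMap.comp_apply, homL_apply]
    -- The gap at `y` acts as the projection onto the empty path if `y = x`, and as `0` otherwise.
    have : lift (pathFamily x) ((univ E).gap y) = 0 := by
      rw [TCKFamily.gap, map_sub, map_sum]
      simp only [map_mul, map_star]
      have h := path_gap x y
      have h0 : indicatorProj {l : List E.Edge | l = [] ∧ x = y} = 0 := by
        ext ξ l
        rw [indicatorProj_apply, if_neg fun h => hy h.2.symm]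
        rfl
      rw [h0] at h
      rw [← h, ← hp]
      simp only [← hsE]
      rfl
    rw [this, map_zero]

end PathSpace

/-! ## The dumbbell graph -/

section Dumbbell

open Toeplitz

theorem sum_dumbbellVertex {M : Type*} [AddCommMonoid M] (f : DumbbellVertex → M) :
    ∑ y, f y = f .v + f .w := by
  classical
  have h : (Finset.univ : Finset DumbbellVertex) = {.v, .w} := by ext y; cases y <;> simp
  rw [h, Finset.sum_pair (by simp)]

theorem sum_dumbbellEdge {M : Type*} [AddCommMonoid M] (f : DumbbellEdge → M) :
    ∑ e, f e = f .loopV₁ + (f .loopV₂ + (f .loopW₁ + (f .loopW₂ + (f .loopW₃ + f .bridge)))) := by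
  classical
  have h : (Finset.univ : Finset DumbbellEdge) =
      {.loopV₁, .loopV₂, .loopW₁, .loopW₂, .loopW₃, .bridge} := by ext e; cases e <;> simp
  rw [h]
  repeat rw [Finset.sum_insert (by simp)]
  rw [Finset.sum_singleton]

open scoped Classical in
theorem sum_range_vtxV {R : Type*} [CommSemiring R] (f : DumbbellVertex → R) :
    ∑ e with dumbbell.r e = vtxV, f (dumbbell.s e) = 2 * f .v + f .w := by
  rw [Finset.sum_filter, sum_dumbbellEdge]
  simp
  ring

open scoped Classical in
theorem sum_range_vtxW {R : Type*} [CommSemiring R] (f : DumbbellVertex → R) :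
    ∑ e with dumbbell.r e = vtxW, f (dumbbell.s e) = 3 * f .w := by
  rw [Finset.sum_filter, sum_dumbbellEdge]
  simp
  ring

theorem dumbbell_isHereditary : dumbbell.IsHereditary {vtxW} := by
  rintro _ _ rfl h
  induction h with
  | refl => rfl
  | tail _ h ih =>
    obtain ⟨e, hr, hs⟩ := h
    rw [Set.mem_singleton_iff] at ih ⊢
    subst ih hs
    revert hr
    cases e <;> simp

theorem dumbbell_vertexMatrix : dumbbell.vertexMatrix vtxV vtxV = 2 ∧
    dumbbell.vertexMatrix vtxV vtxW = 1 ∧ dumbbell.vertexMatrix vtxW vtxV = 0 ∧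
    dumbbell.vertexMatrix vtxW vtxW = 3 := by
  simp only [FinGraph.vertexMatrix, Finset.card_filter, sum_dumbbellEdge]
  simp

variable {q : ℝ} {φ ψ : StrongDual ℂ (Toeplitz dumbbell)}

/-- The constraints on the values of a KMS state at the vertex and gap projections. -/
theorem IsGibbs.dumbbell_values (hφ : IsGibbs q φ) : ∃ t : ℝ, 0 ≤ t ∧
    φ (p vtxW) = t ∧ φ (p vtxV) = (1 - t : ℝ) ∧
    φ ((univ dumbbell).gap vtxV) = ((1 - t) - q * (2 * (1 - t) + t) : ℝ) ∧
    φ ((univ dumbbell).gap vtxW) = (t - q * (3 * t) : ℝ) ∧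
    0 ≤ (1 - t) - q * (2 * (1 - t) + t) ∧ 0 ≤ t - q * (3 * t) ∧ 0 ≤ 1 - t := by
  obtain ⟨hre, him⟩ := Complex.nonneg_iff.1 (hφ.map_p_nonneg vtxW)
  have hw : φ (p vtxW) = ((φ (p vtxW)).re : ℂ) := Complex.ext rfl (by simpa using him.symm)
  set t := (φ (p vtxW)).re
  have hv : φ (p vtxV) = (1 - t : ℝ) := by
    have h := hφ.sum_map_p
    rw [sum_dumbbellVertex, hw] at h
    push_cast
    rw [← h]
    ring
  have hgv : φ ((univ dumbbell).gap vtxV) = ((1 - t) - q * (2 * (1 - t) + t) : ℝ) := by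
    rw [hφ.map_gap, sum_range_vtxV fun y => φ (p y), hv, hw]
    push_cast
    ring
  have hgw : φ ((univ dumbbell).gap vtxW) = (t - q * (3 * t) : ℝ) := by
    rw [hφ.map_gap, sum_range_vtxW fun y => φ (p y), hw]
    push_cast
    ring
  have h1 := hφ.map_gap_nonneg vtxV
  have h2 := hφ.map_gap_nonneg vtxW
  have h3 := hφ.map_p_nonneg vtxV
  rw [hgv, Complex.zero_le_real] at h1
  rw [hgw, Complex.zero_le_real] at h2
  rw [hv, Complex.zero_le_real] at h3
  exact ⟨t, hre, hw, hv, hgv, hgw, h1, h2, h3⟩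

/-- The two vertex values add up to `1`, so one of them is the only free parameter. -/
theorem IsGibbs.dumbbell_ext (hφ : IsGibbs q φ) (hψ : IsGibbs q ψ) (hq : 0 < q) (hq1 : q ≠ 1)
    (h : φ (p vtxW) = ψ (p vtxW)) : φ = ψ := by
  refine hφ.ext hψ hq hq1 fun y => ?_
  cases y with
  | w => exact h
  | v =>
    have h1 := hφ.sum_map_p
    have h2 := hψ.sum_map_p
    rw [sum_dumbbellVertex] at h1 h2
    rw [← h2, h] at h1
    exact add_right_cancel h1

theorem IsGibbs.factorsThrough_dumbbell_iff (hφ : IsGibbs q φ) (hq : q ≠ 0) :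
    FactorsThrough φ (toCuntzKrieger dumbbell) ↔
      φ ((univ dumbbell).gap vtxV) = 0 ∧ φ ((univ dumbbell).gap vtxW) = 0 := by
  rw [hφ.factorsThrough_iff hq]
  exact ⟨fun h => ⟨h _, h _⟩, fun h y => by cases y; exacts [h.1, h.2]⟩

/-! ### Existence -/

theorem vtxV_notMem : vtxV ∉ ({vtxW} : Set dumbbell.V) := by simp

/-- The graph with one vertex and two loops. -/
abbrev bouquet : FinGraph := dumbbell.delete {vtxW} dumbbell_isHereditary

theorem exists_isGibbs_bouquet_of_lt (hq : 0 < q) (hq2 : q < 1 / 2) :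
    ∃ φ : StrongDual ℂ (Toeplitz bouquet), IsGibbs q φ := by
  classical
  have hpos : 0 < 1 - 2 * q := by linarith
  let x : bouquet.V := ⟨vtxV, vtxV_notMem⟩
  have hs : Summable (pathWeight x q) := by
    -- There are `2^n` paths of length `n`, with total weight `∑ (2q)^n = (1 - 2q)⁻¹`.
    refine summable_pathWeight x hq.le (h := fun _ => (1 - 2 * q)⁻¹)
      (fun _ => (inv_pos.2 hpos).le) fun y => ?_
    rw [Finset.sum_const, nsmul_eq_mul]
    have hcard : (Finset.univ.filter fun e : bouquet.Edge => bouquet.r e = y).card ≤ 2 := by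
      refine (Finset.card_le_card_of_injOn (t := {.loopV₁, .loopV₂})
        (fun e : bouquet.Edge => (e.1 : DumbbellEdge)) ?_
        Subtype.val_injective.injOn).trans Finset.card_le_two
      rintro ⟨e, he⟩ -
      revert he
      cases e <;> simp
    have hcard' : ((Finset.univ.filter fun e : bouquet.Edge => bouquet.r e = y).card : ℝ) ≤ 2 := by
      exact_mod_cast hcard
    have h1 : (if x = y then 1 else 0 : ℝ) ≤ 1 := by split_ifs <;> norm_num
    calc _ ≤ 1 + q * (2 * (1 - 2 * q)⁻¹) := by gcongr
      _ = (1 - 2 * q)⁻¹ := by linear_combination -mul_inv_cancel₀ hpos.ne'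
  obtain ⟨φ, hφ, -⟩ := exists_isGibbs x hq.le hs
  exact ⟨φ, hφ⟩

/-- A sequence in `(0, q)` that converges to `q`. -/
theorem exists_seq_lt_tendsto (hq : 0 < q) :
    ∃ u : ℕ → ℝ, (∀ n, 0 < u n ∧ u n < q) ∧ Filter.Tendsto u Filter.atTop (nhds q) := by
  obtain ⟨u, -, hu, hlim⟩ := exists_seq_strictMono_tendsto' hq
  exact ⟨u, hu, hlim⟩

/-- The trace construction breaks down at `q = 1/2`, where the weights are no longer summable; a
limit from below covers it. -/
theorem exists_isGibbs_bouquet (hq : 0 < q) (hq2 : q ≤ 1 / 2) :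
    ∃ φ : StrongDual ℂ (Toeplitz bouquet), IsGibbs q φ := by
  obtain ⟨u, hu, hlim⟩ := exists_seq_lt_tendsto hq
  choose φ hφ using fun n => exists_isGibbs_bouquet_of_lt (hu n).1 ((hu n).2.trans_le hq2)
  obtain ⟨φ₀, h, -⟩ := exists_isGibbs_limit hφ hlim
  exact ⟨φ₀, h⟩

/-- The state concentrated at `v`. -/
theorem exists_isGibbs_dumbbell_v (hq : 0 < q) (hq2 : q ≤ 1 / 2) :
    ∃ φ : StrongDual ℂ (Toeplitz dumbbell), IsGibbs q φ ∧ φ (p vtxW) = 0 ∧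
      FactorsThrough φ (toDelete dumbbell {vtxW} dumbbell_isHereditary) := by
  obtain ⟨ψ, hψ⟩ := exists_isGibbs_bouquet hq hq2
  refine ⟨_, hψ.pullback dumbbell_isHereditary, ?_, .of_isState hψ.isState _⟩
  have h : toDelete dumbbell {vtxW} dumbbell_isHereditary (p vtxW) = 0 :=
    (lift_p _ vtxW).trans (deleteP_of_mem _ (Set.mem_singleton _))
  rw [ContinuousLinearMap.comp_apply, homL_apply, h, map_zero]

theorem exists_isGibbs_dumbbell_w_of_lt (hq : 0 < q) (hq3 : q < 1 / 3) :
    ∃ φ : StrongDual ℂ (Toeplitz dumbbell), IsGibbs q φ ∧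
      φ ((univ dumbbell).gap vtxV) = 0 := by
  classical
  have h2 : 0 < 1 - 2 * q := by linarith
  have h3 : 0 < 1 - 3 * q := by linarith
  have hs : Summable (pathWeight vtxW q) := by
    -- The `w`-column of `(1 - q A)⁻¹`, whose entries are the total weights of the paths from `w` to
    -- `v` and from `w` to `w`.
    obtain ⟨h, hv, hw⟩ : ∃ h : dumbbell.V → ℝ,
        h vtxV = q * (1 - 3 * q)⁻¹ * (1 - 2 * q)⁻¹ ∧ h vtxW = (1 - 3 * q)⁻¹ :=
      ⟨fun y => match y with
        | .v => q * (1 - 3 * q)⁻¹ * (1 - 2 * q)⁻¹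
        | .w => (1 - 3 * q)⁻¹, rfl, rfl⟩
    refine summable_pathWeight vtxW hq.le (h := h) (fun y => ?_) fun y => ?_
    · cases y with
      | v => change 0 ≤ h vtxV; rw [hv]; positivity
      | w => change 0 ≤ h vtxW; rw [hw]; positivity
    · cases y with
      | v =>
        change _ + q * ∑ e with dumbbell.r e = vtxV, h (dumbbell.s e) ≤ h vtxV
        rw [sum_range_vtxV, hv, hw, if_neg (by simp)]
        refine le_of_eq ?_
        linear_combination (-q * (1 - 3 * q)⁻¹) * mul_inv_cancel₀ h2.ne'
      | w =>
        change _ + q * ∑ e with dumbbell.r e = vtxW, h (dumbbell.s e) ≤ h vtxW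
        rw [sum_range_vtxW, hw, if_pos rfl]
        refine le_of_eq ?_
        linear_combination -mul_inv_cancel₀ h3.ne'
  obtain ⟨φ, hφ, h⟩ := exists_isGibbs vtxW hq.le hs
  exact ⟨φ, hφ, h _ (by simp)⟩

/-- The state with mass at `w` that vanishes at the gap projection of `v`. -/
theorem exists_isGibbs_dumbbell_w (hq : 0 < q) (hq3 : q ≤ 1 / 3) :
    ∃ φ : StrongDual ℂ (Toeplitz dumbbell), IsGibbs q φ ∧
      φ ((univ dumbbell).gap vtxV) = 0 := by
  obtain ⟨u, hu, hlim⟩ := exists_seq_lt_tendsto hq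
  choose φ hφ h using fun n => exists_isGibbs_dumbbell_w_of_lt (hu n).1 ((hu n).2.trans_le hq3)
  obtain ⟨φ₀, h₀, hval⟩ := exists_isGibbs_limit hφ hlim
  exact ⟨φ₀, h₀, hval _ _ h⟩

/-! ### The simplex -/

/-- A Gibbs functional is determined by its value `t` at `p_w`. The functional `φ` has `t = 0`, and
`ψ` has the largest value `T` that positivity at the gap of `v` allows, so each `χ` is the convex
combination with parameter `t / T`. -/
theorem setOf_isGibbs_eq_segment (hq : 0 < q) (hq3 : q ≤ 1 / 3) (hφ : IsGibbs q φ)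
    (hφw : φ (p vtxW) = 0) (hψ : IsGibbs q ψ) (hψv : ψ ((univ dumbbell).gap vtxV) = 0) :
    φ ≠ ψ ∧ {χ | IsGibbs q χ} = segment ℝ φ ψ := by
  have hq1 : q ≠ 1 := by linarith
  obtain ⟨T, hT0, hTw, -, hTg, -, -, -, -⟩ := hψ.dumbbell_values
  rw [hψv, eq_comm, Complex.ofReal_eq_zero] at hTg
  -- For `T = 0` the vanishing gap would give `1 - 2q = 0`, which `q ≤ 1/3` excludes.
  have hT : 0 < T := by
    rcases hT0.eq_or_lt with h | h
    · rw [← h] at hTg; linarith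
    · exact h
  refine ⟨?_, Set.Subset.antisymm (fun χ hχ => ?_) ?_⟩
  · rintro rfl
    rw [hTw, Complex.ofReal_eq_zero] at hφw
    exact hT.ne' hφw
  · have hχ' : IsGibbs q χ := hχ
    obtain ⟨t, ht0, htw, -, -, -, htg, -, -⟩ := hχ'.dumbbell_values
    -- The gap at `v` gives `t (1 - q) ≤ 1 - 2q = T (1 - q)`, and `1 - q > 0`.
    have htT : t ≤ T := by nlinarith
    have hdiv : t / T ≤ 1 := (div_le_one hT).2 htT
    have h0 : 0 ≤ 1 - t / T := sub_nonneg.2 hdiv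
    have h0' : 0 ≤ t / T := div_nonneg ht0 hT.le
    refine ⟨1 - t / T, t / T, h0, h0', by ring, ?_⟩
    refine (hφ.convex hψ h0 h0' (by ring)).dumbbell_ext hχ' hq hq1 ?_
    change (1 - t / T) • φ (p vtxW) + (t / T) • ψ (p vtxW) = χ (p vtxW)
    rw [hφw, smul_zero, zero_add, hTw, htw, Complex.real_smul, ← Complex.ofReal_mul,
      div_mul_cancel₀ _ hT.ne']
  · rintro _ ⟨a, b, ha, hb, hab, rfl⟩
    exact hφ.convex hψ ha hb hab

theorem left_mem_extremePoints_segment {V : Type*} [AddCommGroup V] [Module ℝ V] {x y : V}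
    (hxy : x ≠ y) : x ∈ (segment ℝ x y).extremePoints ℝ := by
  refine mem_extremePoints_iff_left.2 ⟨left_mem_segment ℝ x y, ?_⟩
  rw [segment_eq_image']
  rintro _ ⟨a, ha, rfl⟩ _ ⟨b, hb, rfl⟩ ⟨s, t, hs, ht, hst, h⟩
  -- The convex combination has parameter `s a + t b` along the segment. At the endpoint this is
  -- `0`, and both terms are nonnegative.
  have h1 : (s * a + t * b) • (y - x) = 0 := by
    have h2 : s • (x + a • (y - x)) + t • (x + b • (y - x)) =
        (s + t) • x + (s * a + t * b) • (y - x) := by module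
    rw [h2, hst, one_smul] at h
    exact add_eq_left.1 h
  have h2 := (smul_eq_zero.1 h1).resolve_right (sub_ne_zero.2 hxy.symm)
  have h3 : a = 0 := by nlinarith [mul_nonneg hs.le ha.1, mul_nonneg ht.le hb.1, ha.1]
  change x + a • (y - x) = x
  rw [h3, zero_smul, add_zero]

theorem extremePoints_segment {V : Type*} [AddCommGroup V] [Module ℝ V] {x y : V}
    (hxy : x ≠ y) : (segment ℝ x y).extremePoints ℝ = {x, y} := by
  refine Set.Subset.antisymm ?_ ?_
  · rw [← convexHull_pair]
    exact extremePoints_convexHull_subset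
  · rintro z (rfl | rfl)
    · exact left_mem_extremePoints_segment hxy
    · rw [segment_symm]
      exact left_mem_extremePoints_segment hxy.symm

/-! ### The four ranges of the inverse temperature -/

theorem kmsStates_eq {E : FinGraph} {β : ℝ} (hβ : β ≠ 0) :
    kmsStates E β = {φ | IsGibbs (Real.exp (-β)) φ} :=
  Set.ext fun _ => mem_kmsStates_iff hβ

theorem exp_neg_log {a : ℝ} (ha : 0 < a) : Real.exp (-Real.log a) = 1 / a := by
  rw [Real.exp_neg, Real.exp_log ha, one_div]

theorem kmsStates_of_log_three_lt {β : ℝ} (hβ : Real.log 3 < β) :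
    (∃ f : Fin 2 → StrongDual ℂ (Toeplitz dumbbell), AffineIndependent ℝ f ∧
      kmsStates dumbbell β = convexHull ℝ (Set.range f)) ∧
    ∀ φ ∈ kmsStates dumbbell β, ¬ FactorsThrough φ (toCuntzKrieger dumbbell) := by
  have hq : 0 < Real.exp (-β) := Real.exp_pos _
  have hq3 : Real.exp (-β) < 1 / 3 := by
    rw [← exp_neg_log (by norm_num)]
    exact Real.exp_lt_exp.2 (neg_lt_neg hβ)
  constructor
  · obtain ⟨φ, hφ, hφw, -⟩ := exists_isGibbs_dumbbell_v hq (by linarith)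
    obtain ⟨ψ, hψ, hψv⟩ := exists_isGibbs_dumbbell_w hq hq3.le
    obtain ⟨hne, hseg⟩ := setOf_isGibbs_eq_segment hq hq3.le hφ hφw hψ hψv
    refine ⟨![φ, ψ], affineIndependent_of_ne ℝ hne, ?_⟩
    rw [kmsStates_eq ((Real.log_pos (by norm_num)).trans hβ).ne', hseg, Matrix.range_cons,
      Matrix.range_cons, Matrix.range_empty, Set.union_empty, Set.singleton_union,
      convexHull_pair]
  · intro φ hφ h
    have hφ := isGibbs_of_mem_kmsStates hφ
    obtain ⟨h1, h2⟩ := (hφ.factorsThrough_dumbbell_iff hq.ne').1 h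
    obtain ⟨t, -, -, -, hv, hw, -⟩ := hφ.dumbbell_values
    rw [h1, eq_comm, Complex.ofReal_eq_zero] at hv
    rw [h2, eq_comm, Complex.ofReal_eq_zero] at hw
    -- Vanishing at the gap of `w` means `t (1 - 3q) = 0` with `q < 1/3`. Then vanishing at the gap
    -- of `v` would require `q = 1/2`.
    have ht : t = 0 := by
      have : t * (1 - 3 * Real.exp (-β)) = 0 := by linarith
      exact (mul_eq_zero.1 this).resolve_right (by linarith)
    rw [ht] at hv
    linarith

theorem kmsStates_log_three :
    ∃ φv φw : StrongDual ℂ (Toeplitz dumbbell), φv ≠ φw ∧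
      kmsStates dumbbell (Real.log 3) = convexHull ℝ {φv, φw} ∧
      (kmsStates dumbbell (Real.log 3)).extremePoints ℝ = {φv, φw} ∧
      φv (p vtxV) = 1 ∧ φv (p vtxW) = 0 ∧ φw (p vtxV) = 1 / 2 ∧ φw (p vtxW) = 1 / 2 ∧
      ∀ φ ∈ kmsStates dumbbell (Real.log 3),
        FactorsThrough φ (toCuntzKrieger dumbbell) ↔ φ = φw := by
  have h3 : (0 : ℝ) < 1 / 3 := by norm_num
  obtain ⟨φ, hφ, hφw, -⟩ := exists_isGibbs_dumbbell_v h3 (by norm_num)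
  obtain ⟨ψ, hψ, hψv⟩ := exists_isGibbs_dumbbell_w h3 le_rfl
  obtain ⟨hne, hseg⟩ := setOf_isGibbs_eq_segment h3 le_rfl hφ hφw hψ hψv
  have hkms : kmsStates dumbbell (Real.log 3) = {φ | IsGibbs (1 / 3) φ} := by
    rw [kmsStates_eq (Real.log_pos (by norm_num)).ne', exp_neg_log (by norm_num)]
  -- At `q = 1/3` the gap of `w` has value `t (1 - 3q) = 0` for every `t`, so only the gap of `v`
  -- matters; its value vanishes exactly at `t = 1/2`.
  have half : ∀ χ : StrongDual ℂ (Toeplitz dumbbell), IsGibbs (1 / 3) χ →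
      χ ((univ dumbbell).gap vtxV) = 0 → χ (p vtxV) = 1 / 2 ∧ χ (p vtxW) = 1 / 2 ∧
        χ ((univ dumbbell).gap vtxW) = 0 := by
    intro χ hχ h
    obtain ⟨t, -, hw, hv, hgv, hgw, -⟩ := hχ.dumbbell_values
    rw [h, eq_comm, Complex.ofReal_eq_zero] at hgv
    have ht : t = 1 / 2 := by linarith
    rw [hv, hw, hgw, ht]
    norm_num
  refine ⟨φ, ψ, hne, by rw [hkms, hseg, convexHull_pair],
    by rw [hkms, hseg, extremePoints_segment hne], ?_, hφw, (half ψ hψ hψv).1,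
    (half ψ hψ hψv).2.1, fun χ hχ => ?_⟩
  · have h := hφ.sum_map_p
    rwa [sum_dumbbellVertex, hφw, add_zero] at h
  · rw [hkms] at hχ
    have hχ' : IsGibbs (1 / 3) χ := hχ
    rw [hχ'.factorsThrough_dumbbell_iff h3.ne']
    constructor
    · rintro ⟨h, -⟩
      refine hχ'.dumbbell_ext hψ h3 (by norm_num) ?_
      rw [(half χ hχ' h).2.1, (half ψ hψ hψv).2.1]
    · rintro rfl
      exact ⟨hψv, (half χ hψ hψv).2.2⟩

theorem kmsStates_of_log_two_le {β : ℝ} (h2 : Real.log 2 ≤ β) (h3 : β < Real.log 3) :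
    ∃ φv : StrongDual ℂ (Toeplitz dumbbell), kmsStates dumbbell β = {φv} ∧
      φv (p vtxV) = 1 ∧ φv (p vtxW) = 0 ∧
      FactorsThrough φv (toDelete dumbbell {vtxW} dumbbell_isHereditary) ∧
      (FactorsThrough φv (toCuntzKrieger dumbbell) ↔ β = Real.log 2) := by
  have hq : 0 < Real.exp (-β) := Real.exp_pos _
  have hq2 : Real.exp (-β) ≤ 1 / 2 := by
    rw [← exp_neg_log (by norm_num)]
    exact Real.exp_le_exp.2 (neg_le_neg h2)
  have hq3 : 1 / 3 < Real.exp (-β) := by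
    rw [← exp_neg_log (by norm_num)]
    exact Real.exp_lt_exp.2 (neg_lt_neg h3)
  obtain ⟨φ, hφ, hφw, hfac⟩ := exists_isGibbs_dumbbell_v hq hq2
  refine ⟨φ, ?_, ?_, hφw, hfac, ?_⟩
  · rw [kmsStates_eq ((Real.log_pos (by norm_num)).trans_le h2).ne']
    refine Set.Subset.antisymm (fun χ hχ => ?_) (Set.singleton_subset_iff.2 hφ)
    have hχ' : IsGibbs (Real.exp (-β)) χ := hχ
    refine hχ'.dumbbell_ext hφ hq (by linarith) ?_
    obtain ⟨t, ht0, htw, -, -, -, -, hgw, -⟩ := hχ'.dumbbell_values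
    -- Here `t (1 - 3q) ≥ 0` while `1 - 3q < 0`.
    have ht : t = 0 := by nlinarith
    rw [hφw, htw, ht, Complex.ofReal_zero]
  · have h := hφ.sum_map_p
    rwa [sum_dumbbellVertex, hφw, add_zero] at h
  -- With `t = 0` the gap of `w` has value `0` and that of `v` has value `1 - 2q`.
  · obtain ⟨t, -, hw, -, hgv, hgw, -⟩ := hφ.dumbbell_values
    rw [hφw, eq_comm, Complex.ofReal_eq_zero] at hw
    rw [hφ.factorsThrough_dumbbell_iff hq.ne', hgv, hgw, hw, Complex.ofReal_eq_zero,
      Complex.ofReal_eq_zero]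
    constructor
    · rintro ⟨h, -⟩
      have h' : Real.exp (-β) = Real.exp (-Real.log 2) := by
        rw [exp_neg_log (by norm_num)]
        linarith
      exact neg_injective (Real.exp_injective h')
    · rintro rfl
      rw [exp_neg_log (by norm_num)]
      norm_num

theorem kmsStates_of_lt_log_two {β : ℝ} (h2 : β < Real.log 2) : kmsStates dumbbell β = ∅ := by
  have hq2 : 1 / 2 < Real.exp (-β) := by
    rw [← exp_neg_log (by norm_num)]
    exact Real.exp_lt_exp.2 (neg_lt_neg h2)
  refine Set.eq_empty_of_forall_notMem fun φ hφ => ?_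
  -- Only the necessity of the Gibbs relations is used, so `β = 0` needs no separate treatment: `q >
  -- 1/3` forces `t = 0`, and then `1 - 2q ≥ 0` fails.
  obtain ⟨t, ht0, -, -, -, -, hgv, hgw, -⟩ := (isGibbs_of_mem_kmsStates hφ).dumbbell_values
  have ht : t = 0 := by nlinarith
  rw [ht] at hgv
  linarith

end Dumbbell

end GraphAlgebra
end

open GraphAlgebra in
theorem mainTheorem5 :
    -- the vertex matrix of the graph, and the hereditary set `{w}`
    (dumbbell.vertexMatrix vtxV vtxV = 2 ∧ dumbbell.vertexMatrix vtxV vtxW = 1 ∧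
      dumbbell.vertexMatrix vtxW vtxV = 0 ∧ dumbbell.vertexMatrix vtxW vtxW = 3) ∧
    ∃ hw : dumbbell.IsHereditary {vtxW},
    -- `β > ln 3`: a one-dimensional simplex, no element of which factors through `C*(E)`
    (∀ β : ℝ, Real.log 3 < β →
      (∃ f : Fin 2 → StrongDual ℂ (Toeplitz dumbbell), AffineIndependent ℝ f ∧
        kmsStates dumbbell β = convexHull ℝ (Set.range f)) ∧
      ∀ φ ∈ kmsStates dumbbell β, ¬ FactorsThrough φ (toCuntzKrieger dumbbell)) ∧
    -- `β = ln 3`: the simplex with the two extreme points `φ_v`, `φ_w`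
    (∃ φv φw : StrongDual ℂ (Toeplitz dumbbell), φv ≠ φw ∧
      kmsStates dumbbell (Real.log 3) = convexHull ℝ {φv, φw} ∧
      (kmsStates dumbbell (Real.log 3)).extremePoints ℝ = {φv, φw} ∧
      φv (Toeplitz.p vtxV) = 1 ∧ φv (Toeplitz.p vtxW) = 0 ∧
      φw (Toeplitz.p vtxV) = 1 / 2 ∧ φw (Toeplitz.p vtxW) = 1 / 2 ∧
      ∀ φ ∈ kmsStates dumbbell (Real.log 3),
        FactorsThrough φ (toCuntzKrieger dumbbell) ↔ φ = φw) ∧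
    -- `ln 2 ≤ β < ln 3`: a unique state `φ_v`
    (∀ β : ℝ, Real.log 2 ≤ β → β < Real.log 3 →
      ∃ φv : StrongDual ℂ (Toeplitz dumbbell), kmsStates dumbbell β = {φv} ∧
        φv (Toeplitz.p vtxV) = 1 ∧ φv (Toeplitz.p vtxW) = 0 ∧
        FactorsThrough φv (toDelete dumbbell {vtxW} hw) ∧
        (FactorsThrough φv (toCuntzKrieger dumbbell) ↔ β = Real.log 2)) ∧
    -- `β < ln 2`: no states
    (∀ β : ℝ, β < Real.log 2 → kmsStates dumbbell β = ∅) :=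
  ⟨dumbbell_vertexMatrix, dumbbell_isHereditary, fun _ => kmsStates_of_log_three_lt,
    kmsStates_log_three, fun _ => kmsStates_of_log_two_le, fun _ => kmsStates_of_lt_log_two⟩
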